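/- A weighted graph is a (finite or infinite) vertex set $V$ with a symmetric function $w:V\times V\to[0,\infty)$ such that $w_x:=\sum_y w(x,y)<\infty$ for every vertex $x$; its edges are the pairs with $w(x,y)>0$, $\mathrm{dist}$ is the graph distance ($\infty$ if there is no path), and $w_z:=\sum_{x\in z}w_x$ for a vertex set $z$. The random walk moves from $x$ to $y$ with probability $w(x,y)/w_x$, and $T_{oz}\in\{0,1,2,\dots\}\cup\{\infty\}$ is the first time that the walk started at $o$ at time $0$ visits $z$. Let $c>0$ and $p>-2$. For $n\ge 1$ let $\mathcal G_n$ be the class of all weighted graphs $G$ with vertices $o$, $z$ such that $w_o>0$, $\mathrm{dist}(o,z)\ge n$ and $w_z/w_o<c\,n^p$. Then, as $n\to\infty$, $$\inf_{\mathcal G_n}\mathbf E\,T_{oz}\ \sim\ \frac{2n^2}{(p+2)\log n},$$ and, for every $0<\alpha<2/(p+2)$, $$\sup_{\mathcal G_n}\mathbf P\Big[T_{oz}<\frac{\alpha n^2}{\log n}\Big]\ =\ n^{-(\alpha(p+2)-2)^2/(8\alpha)+o(1)},$$ where the $o(1)$ depends only on $n,\alpha,c,p$ and tends to $0$ as $n\to\infty$.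 Both statements also hold when $z$ is allowed to be an arbitrary vertex set instead of a single vertex. -/

import Mathlib

open MeasureTheory ProbabilityTheory Filter Topology Asymptotics
open scoped NNReal ENNReal

universe u

/-- A weighted graph on the vertex set `V`: a symmetric nonnegative function on `V × V` whose
vertex weights `∑ y, w x y` are all finite, so that the random walk makes sense. Loops are
allowed, and `V` may be infinite. -/
structure WeightedGraph (V : Type u) where
  w : V → V → ℝ≥0
  symm : ∀ x y, w x y = w y x
  tsum_ne_top : ∀ x, ∑' y, (w x y : ℝ≥0∞) ≠ ⊤

namespace WeightedGraph

noncomputable section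

variable {V : Type u} (G : WeightedGraph V)

/-- The weight `w_x` of a vertex: the sum of the weights of the edges at `x`. -/
def vertexWeight (x : V) : ℝ≥0∞ := ∑' y, (G.w x y : ℝ≥0∞)

/-- The weight `w_z` of a vertex set: the sum of the weights of its vertices. -/
def setWeight (z : Set V) : ℝ≥0∞ := ∑' x : z, G.vertexWeight x

/-- The graph whose edges are the support of `w` (loops do not matter for distances). -/
def support : SimpleGraph V where
  Adj x y := x ≠ y ∧ G.w x y ≠ 0
  symm := ⟨fun x y h => ⟨h.1.symm, by rw [G.symm y x]; exact h.2⟩⟩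
  loopless := ⟨fun _ h => h.1 rfl⟩

/-- The graph distance from a vertex to a vertex set, `⊤` if the set cannot be reached. -/
def distTo (o : V) (z : Set V) : ℕ∞ := ⨅ x ∈ z, G.support.edist o x

open scoped Classical in
/-- The law of one step of the walk from `x`: it moves to `y` with probability `w x y / w_x`.
(At an isolated vertex, which a walk started elsewhere never visits, the walk stays put.) -/
def step (x : V) : PMF V :=
  if h : ∑' y, (G.w x y : ℝ≥0∞) = 0 then PMF.pure x
  else PMF.normalize (fun y => (G.w x y : ℝ≥0∞)) h (G.tsum_ne_top x)

variable [MeasurableSpace V] [DiscreteMeasurableSpace V]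

/-- The transition kernel of the random walk. -/
def stepKernel : Kernel V V where
  toFun x := (G.step x).toMeasure
  measurable' := Measurable.of_discrete

instance : IsMarkovKernel G.stepKernel :=
  ⟨fun x => by change IsProbabilityMeasure (G.step x).toMeasure; infer_instance⟩

/-- The transition kernel, as a kernel from the past `X 0, …, X n` to the next position. -/
def pastKernel (n : ℕ) : Kernel (Finset.Iic n → V) V :=
  G.stepKernel.comap (fun h => h ⟨n, Finset.mem_Iic.2 le_rfl⟩) (measurable_pi_apply _)

instance (n : ℕ) : IsMarkovKernel (G.pastKernel n) := by
  unfold pastKernel; infer_instance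

/-- The law, on the space of trajectories, of the random walk started at `o` at time `0`. -/
def walkLaw (o : V) : Measure (ℕ → V) :=
  Kernel.traj (X := fun _ => V) G.pastKernel 0 (fun _ => o)

/-- The first time at which a trajectory is in `z`, `⊤` if there is none. -/
def hitTime {V : Type u} (z : Set V) (ω : ℕ → V) : ℝ≥0∞ := ⨅ (k : ℕ) (_ : ω k ∈ z), (k : ℝ≥0∞)

/-- The expectation of the hitting time `T_{oz}`. -/
def expectedHit (o : V) (z : Set V) : ℝ≥0∞ := ∫⁻ ω, hitTime z ω ∂(G.walkLaw o)

/-- The probability that `T_{oz} < t`. -/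
def probHitBefore (o : V) (z : Set V) (t : ℝ) : ℝ≥0∞ :=
  G.walkLaw o {ω | hitTime z ω < ENNReal.ofReal t}

/-- The constraints `n ≤ dist(o, z)` and `w_z / w_o < c n ^ p` (with `w_o > 0`). -/
structure IsAdmissible {V : Type u} (G : WeightedGraph V) (c p : ℝ) (n : ℕ) (o : V) (z : Set V) :
    Prop where
  pos : 0 < G.vertexWeight o
  le_dist : (n : ℕ∞) ≤ G.distTo o z
  weight_lt : G.setWeight z / G.vertexWeight o < ENNReal.ofReal (c * (n : ℝ) ^ p)

end

end WeightedGraph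

noncomputable section

/-- The infimum of `E T_{oz}` over admissible weighted graphs with vertices `o`, `z`. (The
`σ`-algebra on the vertex set is always the one of all subsets.) -/
def infExpectedHit (c p : ℝ) (n : ℕ) : ℝ≥0∞ :=
  ⨅ (V : Type u) (_ : MeasurableSpace V) (_ : DiscreteMeasurableSpace V) (G : WeightedGraph V)
    (o : V) (z : V) (_ : G.IsAdmissible c p n o {z}), G.expectedHit o {z}

/-- The infimum of `E T_{oz}` over admissible weighted graphs with a vertex `o` and a vertex
set `z`. -/
def infExpectedHitSet (c p : ℝ) (n : ℕ) : ℝ≥0∞ :=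
  ⨅ (V : Type u) (_ : MeasurableSpace V) (_ : DiscreteMeasurableSpace V) (G : WeightedGraph V)
    (o : V) (z : Set V) (_ : G.IsAdmissible c p n o z), G.expectedHit o z

/-- The supremum of `P[T_{oz} < t]` over admissible weighted graphs with vertices `o`, `z`. -/
def supProbHit (c p : ℝ) (n : ℕ) (t : ℝ) : ℝ≥0∞ :=
  ⨆ (V : Type u) (_ : MeasurableSpace V) (_ : DiscreteMeasurableSpace V) (G : WeightedGraph V)
    (o : V) (z : V) (_ : G.IsAdmissible c p n o {z}), G.probHitBefore o {z} t

/-- The supremum of `P[T_{oz} < t]` over admissible weighted graphs with a vertex `o` and a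
vertex set `z`. -/
def supProbHitSet (c p : ℝ) (n : ℕ) (t : ℝ) : ℝ≥0∞ :=
  ⨆ (V : Type u) (_ : MeasurableSpace V) (_ : DiscreteMeasurableSpace V) (G : WeightedGraph V)
    (o : V) (z : Set V) (_ : G.IsAdmissible c p n o z), G.probHitBefore o z t

end

/-
Both estimates come from the Laplace transform of `T` at the killing rate `l = ℓ (log n / n) ^ 2`.
For a finite network, let `h x = E_x[exp (-l T_z)]` and `k x = E_x[exp (-l T_o)]`. The antisymmetric
current `w x y (h y k x - h x k y)` has no divergence off `o` and `z`, so it carries its strength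
across the distance `n`. Pinsker's inequality bounds it at each vertex by the entropies that the
walks conditioned by `h` and by `k` produce there, and these telescope to `-log (h o)` and
`-log (k z)`; hence `log (h o) * log (k z)` is at least `2 l n ^ 2` to leading order. Reversibility
bounds `h o / k z` by `w_z / (l w_o)` up to a constant. Together,
`h o ≤ n ^ (-(√(q ^ 2 + 2 ℓ) - q) + o(1))` with `q = (p + 2) / 2`. Optimizing Chernoff's bound over
`ℓ` gives the upper bound for the probability, and hence the lower bound for the expectation.

Both are attained on the path whose edge weights grow by the factor `1 + (p + 2 - o(1)) log n / n`,
with a heavy loop at the start. Superharmonic and subharmonic functions bound its mean hitting time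
and its Laplace transform. As the exponent is differentiable in `ℓ`, comparison with nearby rates
shows that the transform is carried by times close to `α n ^ 2 / log n`.
-/

open InformationTheory

theorem hasDerivAt_log_sub_div {x : ℝ} (hx : 0 < x) :
    HasDerivAt (fun x : ℝ => Real.log x - (x - 1) * (5 * x + 1) / (2 * x * (x + 2)))
      ((x - 1) ^ 3 / (x ^ 2 * (x + 2) ^ 2)) x := by
  have hnum : HasDerivAt (fun x : ℝ => (x - 1) * (5 * x + 1))
      (1 * (5 * x + 1) + (x - 1) * (5 * 1)) x :=
    ((hasDerivAt_id x).sub_const 1).mul (((hasDerivAt_id x).const_mul 5).add_const 1)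
  have hden : HasDerivAt (fun x : ℝ => 2 * x * (x + 2)) ((2 * 1) * (x + 2) + 2 * x * 1) x :=
    ((hasDerivAt_id x).const_mul 2).mul ((hasDerivAt_id x).add_const 2)
  refine ((Real.hasDerivAt_log hx.ne').sub (hnum.div hden (by positivity))).congr_deriv ?_
  field_simp
  ring

theorem sub_one_mul_div_le_log {u : ℝ} (hu : 0 < u) :
    (u - 1) * (5 * u + 1) / (2 * u * (u + 2)) ≤ Real.log u := by
  set g : ℝ → ℝ := fun x => Real.log x - (x - 1) * (5 * x + 1) / (2 * x * (x + 2)) with hg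
  have hderiv {x : ℝ} (hx : 0 < x) : HasDerivAt g ((x - 1) ^ 3 / (x ^ 2 * (x + 2) ^ 2)) x :=
    hasDerivAt_log_sub_div hx
  suffices g 1 ≤ g u by simpa [hg] using this
  rcases le_total u 1 with h | h
  · have hanti : AntitoneOn g (Set.Ioc 0 1) := by
      refine antitoneOn_of_hasDerivWithinAt_nonpos (convex_Ioc 0 1)
        (fun x hx => (hderiv hx.1).continuousAt.continuousWithinAt)
        (fun x hx => (hderiv (interior_subset hx).1).hasDerivWithinAt) fun x hx => ?_
      exact div_nonpos_of_nonpos_of_nonneg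
        (Odd.pow_nonpos (by decide) (sub_nonpos.2 (interior_subset hx).2)) (by positivity)
    exact hanti ⟨hu, h⟩ ⟨one_pos, le_rfl⟩ h
  · have hmono : MonotoneOn g (Set.Ici 1) := by
      have hpos {x : ℝ} (hx : x ∈ Set.Ici 1) : 0 < x := one_pos.trans_le hx
      refine monotoneOn_of_hasDerivWithinAt_nonneg (convex_Ici 1)
        (fun x hx => (hderiv (hpos hx)).continuousAt.continuousWithinAt)
        (fun x hx => (hderiv (hpos (interior_subset hx))).hasDerivWithinAt) fun x hx => ?_
      exact div_nonneg (pow_nonneg (sub_nonneg.2 (interior_subset hx)) 3) (by positivity)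
    exact hmono Set.self_mem_Ici h h

theorem three_mul_sq_div_le_klFun {u : ℝ} (hu : 0 ≤ u) :
    3 * (u - 1) ^ 2 / (2 * (u + 2)) ≤ klFun u := by
  rcases hu.eq_or_lt with rfl | hu
  · norm_num [klFun_zero]
  · have h := mul_le_mul_of_nonneg_left (sub_one_mul_div_le_log hu) hu.le
    have e : 3 * (u - 1) ^ 2 / (2 * (u + 2)) =
        u * ((u - 1) * (5 * u + 1) / (2 * u * (u + 2))) + 1 - u := by
      field_simp
      ring
    rw [klFun_apply, e]
    linarith

/- The proof of Pinsker's inequality: `(h - b)² / (h + 2b)` is at most `2/3` of the relative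
entropy, and Cauchy–Schwarz removes the denominators. -/
theorem sq_sum_mul_abs_sub_le_sum_klFun {ι : Type*} (s : Finset ι) {w h : ι → ℝ}
    (hw : ∀ y, 0 ≤ w y) (hh : ∀ y, 0 ≤ h y) {b : ℝ} (hb : 0 < b) :
    (∑ y ∈ s, w y * |h y - b|) ^ 2 ≤
      2 / 3 * (∑ y ∈ s, w y * (h y + 2 * b)) * ∑ y ∈ s, w y * (b * klFun (h y / b)) := by
  have hpos (y : ι) : 0 < h y + 2 * b := by linarith [hh y]
  have hpoint (y : ι) : (h y - b) ^ 2 ≤ 2 / 3 * (h y + 2 * b) * (b * klFun (h y / b)) := by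
    have hkl := mul_le_mul_of_nonneg_left (three_mul_sq_div_le_klFun (div_nonneg (hh y) hb.le))
      (show 0 ≤ 2 / 3 * (h y + 2 * b) * b by have := hpos y; positivity)
    refine le_of_eq_of_le ?_ (hkl.trans_eq (by ring))
    have : h y + b * 2 ≠ 0 := by linarith [hpos y]
    field_simp
  rw [Finset.mul_sum s _ (2 / 3 : ℝ)]
  refine Finset.sum_sq_le_sum_mul_sum_of_sq_le_mul s
    (fun y _ => mul_nonneg (by norm_num) (mul_nonneg (hw y) (hpos y).le))
    (fun y _ => mul_nonneg (hw y) (mul_nonneg hb.le (klFun_nonneg (div_nonneg (hh y) hb.le))))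
    fun y _ => ?_
  rw [mul_pow, sq_abs]
  linarith [mul_le_mul_of_nonneg_left (hpoint y) (sq_nonneg (w y))]

section Flow

variable {ι : Type*} [Fintype ι] {θ : ι → ι → ℝ}

theorem sum_sum_eq_zero_of_antisymm (hθ : ∀ x y, θ x y = -θ y x) : ∑ x, ∑ y, θ x y = 0 := by
  have h : ∑ x, ∑ y, θ x y = -∑ x, ∑ y, θ x y := by
    conv_lhs => rw [Finset.sum_comm]
    simp only [← Finset.sum_neg_distrib, ← hθ]
  linarith

theorem sum_eq_neg_sum_of_flow (hθ : ∀ x y, θ x y = -θ y x) {o z : ι} (hoz : o ≠ z)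
    (hdiv : ∀ x, x ≠ o → x ≠ z → ∑ y, θ x y = 0) : ∑ y, θ z y = -∑ y, θ o y := by
  have h := sum_sum_eq_zero_of_antisymm hθ
  rw [Fintype.sum_eq_add o z hoz fun x hx => hdiv x hx.1 hx.2] at h
  linarith

theorem sum_sum_flow_mul_sub (hθ : ∀ x y, θ x y = -θ y x) {o z : ι} (hoz : o ≠ z)
    (hdiv : ∀ x, x ≠ o → x ≠ z → ∑ y, θ x y = 0) (f : ι → ℝ) :
    ∑ x, ∑ y, θ x y * (f x - f y) = 2 * ((∑ y, θ o y) * (f o - f z)) := by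
  have hleft : ∑ x, ∑ y, θ x y * f x = (∑ y, θ o y) * (f o - f z) := by
    simp only [← Finset.sum_mul]
    rw [Fintype.sum_eq_add o z hoz fun x hx => by rw [hdiv x hx.1 hx.2, zero_mul],
      sum_eq_neg_sum_of_flow hθ hoz hdiv]
    ring
  have hright : ∑ x, ∑ y, θ x y * f y = -∑ x, ∑ y, θ x y * f x := by
    rw [Finset.sum_comm]
    simp only [← Finset.sum_neg_distrib, ← neg_mul, ← hθ]
  simp only [mul_sub, Finset.sum_sub_distrib, hright, hleft]
  ring

end Flow

/-- A finite reversible walk with killing: it moves from `x` to `y` with probability `w x y / W x`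
and dies at `x` with the remaining probability. -/
structure KilledNetwork (ι : Type*) [Fintype ι] where
  w : ι → ι → ℝ
  W : ι → ℝ
  symm : ∀ x y, w x y = w y x
  nonneg : ∀ x y, 0 ≤ w x y
  sum_le : ∀ x, ∑ y, w x y ≤ W x

namespace KilledNetwork

variable {ι : Type*} [Fintype ι] (N : KilledNetwork ι)

/-- The equations satisfied by `h x = E_x[m ^ (-T)]`, where `T` is the hitting time of `z`. -/
structure IsDiscounted (m : ℝ) (z : ι) (h : ι → ℝ) : Prop where
  nonneg : ∀ x, 0 ≤ h x
  le_one : ∀ x, h x ≤ 1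
  target : h z = 1
  mean : ∀ x, x ≠ z → ∑ y, N.w x y * h y = m * N.W x * h x

theorem weight_nonneg (x : ι) : 0 ≤ N.W x :=
  (Finset.sum_nonneg fun y _ => N.nonneg x y).trans (N.sum_le x)

theorem exists_isDiscounted {m : ℝ} (hm : 1 ≤ m) (z : ι) : ∃ h, N.IsDiscounted m z h := by
  classical
  have hmW (x : ι) : N.W x ≤ m * N.W x := le_mul_of_one_le_left (N.weight_nonneg x) hm
  have hsum_nonneg (h : ι → Set.Icc (0 : ℝ) 1) (x : ι) : 0 ≤ ∑ y, N.w x y * h y :=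
    Finset.sum_nonneg fun y _ => mul_nonneg (N.nonneg x y) (h y).2.1
  have hsum_le (h : ι → Set.Icc (0 : ℝ) 1) (x : ι) : ∑ y, N.w x y * h y ≤ N.W x :=
    (Finset.sum_le_sum fun y _ => mul_le_of_le_one_right (N.nonneg x y) (h y).2.2).trans
      (N.sum_le x)
  have : Fact ((0 : ℝ) ≤ 1) := ⟨zero_le_one⟩
  let Ψ : (ι → Set.Icc (0 : ℝ) 1) →o (ι → Set.Icc (0 : ℝ) 1) :=
    { toFun h x := if x = z then 1 else ⟨(∑ y, N.w x y * h y) / (m * N.W x),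
        div_nonneg (hsum_nonneg h x) ((N.weight_nonneg x).trans (hmW x)),
        div_le_one_of_le₀ ((hsum_le h x).trans (hmW x)) ((N.weight_nonneg x).trans (hmW x))⟩
      monotone' h h' hle x := by
        dsimp only
        split_ifs
        · exact le_rfl
        · refine div_le_div_of_nonneg_right (Finset.sum_le_sum fun y _ => ?_)
            ((N.weight_nonneg x).trans (hmW x))
          exact mul_le_mul_of_nonneg_left (hle y) (N.nonneg x y) }
  obtain ⟨h, hfix⟩ : ∃ h, Ψ h = h := ⟨Ψ.lfp, Ψ.map_lfp⟩
  refine ⟨fun x => h x, fun x => (h x).2.1, fun x => (h x).2.2, ?_, fun x hx => ?_⟩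
  · exact congrArg Subtype.val ((congrFun hfix z).symm.trans (if_pos rfl))
  · have hmean : (h x : ℝ) = (∑ y, N.w x y * h y) / (m * N.W x) :=
      congrArg Subtype.val ((congrFun hfix x).symm.trans (if_neg hx))
    by_cases hW : N.W x = 0
    · rw [hW, mul_zero, zero_mul]
      exact le_antisymm ((hsum_le _ x).trans_eq hW) (hsum_nonneg _ x)
    · have : m ≠ 0 := (one_pos.trans_le hm).ne'
      rw [hmean]
      field_simp

/-- The current between two discounted hitting functions: since `h` and `k` satisfy the same
equations off their targets, it has no divergence there. -/
def flow (h k : ι → ℝ) (x y : ι) : ℝ := N.w x y * (h y * k x - h x * k y)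

/-- The entropy production at a vertex: up to normalization, the relative entropy of a step of the
walk conditioned by `h` with respect to the walk itself. -/
noncomputable def entropyProduction (h : ι → ℝ) (x : ι) : ℝ :=
  ∑ y, N.w x y * h y * (Real.log (h y) - Real.log (h x))

variable {N}
variable {m : ℝ} {o z x : ι} {h k : ι → ℝ}

theorem flow_antisymm (x y : ι) : N.flow h k x y = -N.flow h k y x := by
  simp only [flow, N.symm x y]
  ring

theorem sum_flow (x : ι) :
    ∑ y, N.flow h k x y = k x * ∑ y, N.w x y * h y - h x * ∑ y, N.w x y * k y := by
  simp only [flow, Finset.mul_sum, ← Finset.sum_sub_distrib]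
  exact Finset.sum_congr rfl fun y _ => by ring

namespace IsDiscounted

theorem sum_flow_eq_zero (hh : N.IsDiscounted m z h) (hk : N.IsDiscounted m o k)
    (x : ι) (hxo : x ≠ o) (hxz : x ≠ z) : ∑ y, N.flow h k x y = 0 := by
  rw [sum_flow, hh.mean x hxz, hk.mean x hxo]
  ring

theorem sum_mul_nonneg (hk : N.IsDiscounted m o k) (x : ι) : 0 ≤ ∑ y, N.w x y * k y :=
  Finset.sum_nonneg fun y _ => mul_nonneg (N.nonneg x y) (hk.nonneg y)

theorem sum_mul_le (hk : N.IsDiscounted m o k) (x : ι) : ∑ y, N.w x y * k y ≤ N.W x :=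
  (Finset.sum_le_sum fun y _ => mul_le_of_le_one_right (N.nonneg x y) (hk.le_one y)).trans
    (N.sum_le x)

theorem sum_flow_source (hh : N.IsDiscounted m z h) (hk : N.IsDiscounted m o k) (hoz : o ≠ z) :
    ∑ y, N.flow h k o y = h o * (m * N.W o - ∑ y, N.w o y * k y) := by
  rw [sum_flow, hh.mean o hoz, hk.target]
  ring

theorem sum_flow_source_eq_target (hh : N.IsDiscounted m z h) (hk : N.IsDiscounted m o k)
    (hoz : o ≠ z) : ∑ y, N.flow h k o y = k z * (m * N.W z - ∑ y, N.w z y * h y) := by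
  have hz := sum_eq_neg_sum_of_flow flow_antisymm hoz (hh.sum_flow_eq_zero hk)
  rw [sum_flow, hk.mean z hoz.symm, hh.target] at hz
  linarith

theorem sum_flow_swap (hh : N.IsDiscounted m z h) (hk : N.IsDiscounted m o k) (hoz : o ≠ z) :
    ∑ y, N.flow k h z y = ∑ y, N.flow h k o y := by
  rw [hh.sum_flow_source_eq_target hk hoz, hk.sum_flow_source hh hoz.symm]

theorem mul_weight_source_le (hh : N.IsDiscounted m z h) (hk : N.IsDiscounted m o k)
    (hoz : o ≠ z) : h o * (m - 1) * N.W o ≤ k z * m * N.W z :=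
  calc h o * (m - 1) * N.W o ≤ h o * (m * N.W o - ∑ y, N.w o y * k y) := by
        rw [mul_assoc]
        exact mul_le_mul_of_nonneg_left (by linarith [hk.sum_mul_le o]) (hh.nonneg o)
    _ = k z * (m * N.W z - ∑ y, N.w z y * h y) := by
        rw [← hh.sum_flow_source hk hoz, hh.sum_flow_source_eq_target hk hoz]
    _ ≤ k z * m * N.W z := by
        rw [mul_assoc]
        exact mul_le_mul_of_nonneg_left (sub_le_self _ (hh.sum_mul_nonneg z)) (hk.nonneg z)

theorem log_mul_add_sq_div_le_entropyProduction (hh : N.IsDiscounted m z h) (hm : 0 < m)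
    (hx : x ≠ z) (hhx : 0 < h x) (hW : 0 < N.W x) :
    m * Real.log m * (N.W x * h x) +
        (∑ y, N.w x y * |h y - m * h x|) ^ 2 / (2 * m * (N.W x * h x)) ≤
      N.entropyProduction h x := by
  set b := m * h x with hb_def
  have hb : 0 < b := mul_pos hm hhx
  set D := ∑ y, N.w x y * (b * klFun (h y / b)) with hD
  have hDnonneg : 0 ≤ D := Finset.sum_nonneg fun y _ => mul_nonneg (N.nonneg x y)
    (mul_nonneg hb.le (klFun_nonneg (div_nonneg (hh.nonneg y) hb.le)))
  have hpinsker := sq_sum_mul_abs_sub_le_sum_klFun Finset.univ (N.nonneg x) hh.nonneg hb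
  rw [← hD] at hpinsker
  have hpoint (y : ι) : h y * (Real.log (h y) - Real.log (h x)) =
      Real.log m * h y + (h y - b) + b * klFun (h y / b) := by
    rcases (hh.nonneg y).eq_or_lt with h0 | h0
    · simp [← h0, klFun_zero]
    · rw [klFun_apply, Real.log_div h0.ne' hb.ne', hb_def, Real.log_mul hm.ne' hhx.ne']
      field_simp
      ring
  have hentropy : N.entropyProduction h x =
      Real.log m * (m * N.W x * h x) + (m * N.W x * h x - b * ∑ y, N.w x y) + D := by
    simp only [entropyProduction, mul_assoc (N.w x _), hpoint, hD, ← hh.mean x hx, Finset.mul_sum,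
      ← Finset.sum_sub_distrib, ← Finset.sum_add_distrib]
    exact Finset.sum_congr rfl fun y _ => by ring
  have hsum : b * ∑ y, N.w x y ≤ b * N.W x := mul_le_mul_of_nonneg_left (N.sum_le x) hb.le
  have hfactor : ∑ y, N.w x y * (h y + 2 * b) ≤ 3 * (m * (N.W x * h x)) := by
    simp only [mul_add, Finset.sum_add_distrib, ← Finset.sum_mul, hh.mean x hx]
    linarith
  have hdiv : (∑ y, N.w x y * |h y - b|) ^ 2 / (2 * m * (N.W x * h x)) ≤ D := by
    rw [div_le_iff₀ (by positivity)]
    linarith [mul_le_mul_of_nonneg_right hfactor hDnonneg]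
  rw [hentropy]
  linarith

theorem mul_eq_zero (hh : N.IsDiscounted m z h) (hx : x ≠ z) (h0 : h x = 0 ∨ N.W x = 0) (y : ι) :
    N.w x y * h y = 0 := by
  have hsum : ∑ y, N.w x y * h y = 0 := by
    rw [hh.mean x hx]
    rcases h0 with h0 | h0 <;> simp [h0]
  exact (Finset.sum_eq_zero_iff_of_nonneg fun y _ => mul_nonneg (N.nonneg x y) (hh.nonneg y)).1
    hsum y (Finset.mem_univ _)

theorem entropyProduction_nonneg (hh : N.IsDiscounted m z h) (hm : 1 < m) (hx : x ≠ z) :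
    0 ≤ N.entropyProduction h x := by
  by_cases h0 : h x = 0 ∨ N.W x = 0
  · simp [entropyProduction, hh.mul_eq_zero hx h0]
  · push Not at h0
    have hhx : 0 < h x := (hh.nonneg x).lt_of_ne' h0.1
    have hW : 0 < N.W x := (N.weight_nonneg x).lt_of_ne' h0.2
    have hm0 : 0 < m := one_pos.trans hm
    have := Real.log_pos hm
    exact le_trans (by positivity) (hh.log_mul_add_sq_div_le_entropyProduction hm0 hx hhx hW)

theorem neg_le_entropyProduction_target (hh : N.IsDiscounted m z h) (hm : 1 ≤ m) :
    -(m * N.W z - ∑ y, N.w z y * h y) ≤ N.entropyProduction h z := by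
  have hpoint (y : ι) : N.w z y * h y - N.w z y ≤ N.w z y * h y * Real.log (h y) := by
    have := mul_nonneg (N.nonneg z y) (klFun_nonneg (hh.nonneg y))
    rw [klFun_apply] at this
    linarith
  have hsum : ∑ y, N.w z y * h y - ∑ y, N.w z y ≤ N.entropyProduction h z := by
    rw [entropyProduction, ← Finset.sum_sub_distrib, hh.target, Real.log_one]
    simpa only [sub_zero] using Finset.sum_le_sum fun y _ => hpoint y
  have := le_mul_of_one_le_left (N.weight_nonneg z) hm
  linarith [N.sum_le z]

theorem sum_mul_entropyProduction (hh : N.IsDiscounted m z h) (hk : N.IsDiscounted m o k)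
    (hoz : o ≠ z) :
    ∑ x, k x * N.entropyProduction h x = (∑ y, N.flow h k o y) * -Real.log (h o) := by
  have hparts := sum_sum_flow_mul_sub flow_antisymm hoz (hh.sum_flow_eq_zero hk)
    fun x => -Real.log (h x)
  rw [hh.target, Real.log_one, neg_zero, sub_zero] at hparts
  have hswap : ∑ x, k x * N.entropyProduction h x =
      ∑ x, ∑ y, N.w x y * h x * k y * (Real.log (h x) - Real.log (h y)) := by
    rw [Finset.sum_comm]
    simp only [entropyProduction, Finset.mul_sum]
    refine Finset.sum_congr rfl fun x _ => Finset.sum_congr rfl fun y _ => ?_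
    rw [N.symm x y]
    ring
  have hflow : ∑ x, ∑ y, N.flow h k x y * (-Real.log (h x) - -Real.log (h y)) =
      ∑ x, k x * N.entropyProduction h x + ∑ x, k x * N.entropyProduction h x := by
    nth_rewrite 2 [hswap]
    simp only [entropyProduction, Finset.mul_sum, ← Finset.sum_add_distrib]
    refine Finset.sum_congr rfl fun x _ => Finset.sum_congr rfl fun y _ => ?_
    rw [flow]
    ring
  linarith

theorem sum_compl_pair_entropyProduction_le [DecidableEq ι] (hh : N.IsDiscounted m z h)
    (hk : N.IsDiscounted m o k) (hm : 1 < m) (hoz : o ≠ z) :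
    ∑ x ∈ {o, z}ᶜ, k x * N.entropyProduction h x ≤
      (∑ y, N.flow h k o y) * (-Real.log (h o) + 1) := by
  have htotal := hh.sum_mul_entropyProduction hk hoz
  rw [← Finset.sum_add_sum_compl {o, z}, Finset.sum_pair hoz] at htotal
  have hsource : 0 ≤ k o * N.entropyProduction h o :=
    mul_nonneg (hk.nonneg o) (hh.entropyProduction_nonneg hm hoz)
  have htarget : -∑ y, N.flow h k o y ≤ k z * N.entropyProduction h z := by
    rw [hh.sum_flow_source_eq_target hk hoz, ← mul_neg]
    exact mul_le_mul_of_nonneg_left (hh.neg_le_entropyProduction_target hm.le) (hk.nonneg z)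
  linarith

theorem sum_abs_flow_le (hh : N.IsDiscounted m z h) (hk : N.IsDiscounted m o k) (x : ι) :
    ∑ y, |N.flow h k x y| ≤ k x * ∑ y, N.w x y * |h y - m * h x| +
      h x * ∑ y, N.w x y * |k y - m * k x| := by
  rw [Finset.mul_sum, Finset.mul_sum, ← Finset.sum_add_distrib]
  refine Finset.sum_le_sum fun y _ => ?_
  calc |N.flow h k x y|
      = N.w x y * |k x * (h y - m * h x) - h x * (k y - m * k x)| := by
        rw [flow, ← abs_of_nonneg (N.nonneg x y), ← abs_mul, abs_of_nonneg (N.nonneg x y)]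
        ring_nf
    _ ≤ N.w x y * (|k x * (h y - m * h x)| + |h x * (k y - m * k x)|) :=
        mul_le_mul_of_nonneg_left (abs_sub _ _) (N.nonneg x y)
    _ = _ := by
        rw [abs_mul, abs_mul, abs_of_nonneg (hh.nonneg x), abs_of_nonneg (hk.nonneg x)]
        ring

theorem flow_eq_zero (hh : N.IsDiscounted m z h) (hk : N.IsDiscounted m o k) (hxo : x ≠ o)
    (hxz : x ≠ z) (h0 : h x = 0 ∨ k x = 0 ∨ N.W x = 0) (y : ι) : N.flow h k x y = 0 := by
  have hflow : N.flow h k x y = k x * (N.w x y * h y) - h x * (N.w x y * k y) := by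
    rw [flow]
    ring
  rw [hflow]
  rcases h0 with h0 | h0 | h0
  · rw [hh.mul_eq_zero hxz (.inl h0), h0, mul_zero, zero_mul, sub_zero]
  · rw [hk.mul_eq_zero hxo (.inl h0), h0, mul_zero, zero_mul, sub_zero]
  · rw [hk.mul_eq_zero hxo (.inr h0), hh.mul_eq_zero hxz (.inr h0), mul_zero, mul_zero, sub_zero]

theorem sq_sum_abs_flow_le (hh : N.IsDiscounted m z h) (hk : N.IsDiscounted m o k)
    (hm : 1 < m) (hxo : x ≠ o) (hxz : x ≠ z) :
    Real.log m / 2 * (∑ y, |N.flow h k x y|) ^ 2 ≤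
      (k x * N.entropyProduction h x) * (h x * N.entropyProduction k x) := by
  by_cases h0 : h x = 0 ∨ k x = 0 ∨ N.W x = 0
  · simp only [hh.flow_eq_zero hk hxo hxz h0, abs_zero, Finset.sum_const_zero,
      zero_pow two_ne_zero, mul_zero]
    exact mul_nonneg (mul_nonneg (hk.nonneg x) (hh.entropyProduction_nonneg hm hxz))
      (mul_nonneg (hh.nonneg x) (hk.entropyProduction_nonneg hm hxo))
  push Not at h0
  have hhx : 0 < h x := (hh.nonneg x).lt_of_ne' h0.1
  have hkx : 0 < k x := (hk.nonneg x).lt_of_ne' h0.2.1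
  have hW : 0 < N.W x := (N.weight_nonneg x).lt_of_ne' h0.2.2
  have hm0 : 0 < m := one_pos.trans hm
  have hlog := Real.log_pos hm
  set a := k x * ∑ y, N.w x y * |h y - m * h x| with ha
  set b := h x * ∑ y, N.w x y * |k y - m * k x| with hb
  set M := m * (N.W x * h x * k x) with hM
  have hM0 : 0 < M := by positivity
  have hsum : ∑ y, |N.flow h k x y| ≤ a + b := hh.sum_abs_flow_le hk x
  have hA : Real.log m * M + a ^ 2 / (2 * M) ≤ k x * N.entropyProduction h x := by
    refine le_of_eq_of_le ?_ (mul_le_mul_of_nonneg_left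
      (hh.log_mul_add_sq_div_le_entropyProduction hm0 hxz hhx hW) hkx.le)
    rw [ha, hM]
    field_simp
  have hB : Real.log m * M + b ^ 2 / (2 * M) ≤ h x * N.entropyProduction k x := by
    refine le_of_eq_of_le ?_ (mul_le_mul_of_nonneg_left
      (hk.log_mul_add_sq_div_le_entropyProduction hm0 hxo hkx hW) hhx.le)
    rw [hb, hM]
    field_simp
  have hsq : (Real.log m * M + a ^ 2 / (2 * M)) * (Real.log m * M + b ^ 2 / (2 * M)) =
      Real.log m / 2 * (a + b) ^ 2 + (Real.log m * M - a * b / (2 * M)) ^ 2 := by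
    field_simp
    ring
  calc Real.log m / 2 * (∑ y, |N.flow h k x y|) ^ 2 ≤ Real.log m / 2 * (a + b) ^ 2 := by gcongr
    _ ≤ (Real.log m * M + a ^ 2 / (2 * M)) * (Real.log m * M + b ^ 2 / (2 * M)) :=
        hsq ▸ le_add_of_nonneg_right (sq_nonneg _)
    _ ≤ _ := mul_le_mul hA hB (by positivity) (le_trans (by positivity) hA)

theorem sq_sum_compl_pair_abs_flow_le [DecidableEq ι] (hh : N.IsDiscounted m z h)
    (hk : N.IsDiscounted m o k) (hm : 1 < m) (hoz : o ≠ z) :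
    Real.log m / 2 * (∑ x ∈ {o, z}ᶜ, ∑ y, |N.flow h k x y|) ^ 2 ≤
      (∑ y, N.flow h k o y) * (-Real.log (h o) + 1) *
        ((∑ y, N.flow h k o y) * (-Real.log (k z) + 1)) := by
  have hlog := Real.log_pos hm
  have hA := hh.sum_compl_pair_entropyProduction_le hk hm hoz
  have hB := hk.sum_compl_pair_entropyProduction_le hh hm hoz.symm
  rw [hh.sum_flow_swap hk hoz, Finset.pair_comm] at hB
  have hinterior {x : ι} (hx : x ∈ ({o, z} : Finset ι)ᶜ) : x ≠ o ∧ x ≠ z := by simpa using hx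
  have hhE (x : ι) (hx : x ∈ ({o, z} : Finset ι)ᶜ) : 0 ≤ k x * N.entropyProduction h x :=
    mul_nonneg (hk.nonneg x) (hh.entropyProduction_nonneg hm (hinterior hx).2)
  have hkE (x : ι) (hx : x ∈ ({o, z} : Finset ι)ᶜ) : 0 ≤ h x * N.entropyProduction k x :=
    mul_nonneg (hh.nonneg x) (hk.entropyProduction_nonneg hm (hinterior hx).1)
  have hcs := Finset.sum_sq_le_sum_mul_sum_of_sq_le_mul ({o, z} : Finset ι)ᶜ
    (r := fun x => ∑ y, |N.flow h k x y|)
    (f := fun x => 2 / Real.log m * (k x * N.entropyProduction h x))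
    (fun x hx => mul_nonneg (by positivity) (hhE x hx)) hkE fun x hx => by
      have := hh.sq_sum_abs_flow_le hk hm (hinterior hx).1 (hinterior hx).2
      rw [mul_assoc, div_mul_eq_mul_div, le_div_iff₀ hlog]
      linarith
  rw [← Finset.mul_sum, mul_assoc, div_mul_eq_mul_div, le_div_iff₀ hlog] at hcs
  have hprod := mul_le_mul hA hB (Finset.sum_nonneg hkE) ((Finset.sum_nonneg hhE).trans hA)
  linarith

theorem two_mul_sum_flow_mul_le [DecidableEq ι] (hh : N.IsDiscounted m z h)
    (hk : N.IsDiscounted m o k) (hoz : o ≠ z) {d : ι → ℝ}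
    (hd : ∀ x y, N.w x y ≠ 0 → |d x - d y| ≤ 1) (hdo : ∀ y, N.w o y ≠ 0 → d y = d o)
    (hdz : ∀ y, N.w z y ≠ 0 → d y = d z) :
    2 * ((∑ y, N.flow h k o y) * (d z - d o)) ≤ ∑ x ∈ {o, z}ᶜ, ∑ y, |N.flow h k x y| := by
  have hboundary {x y : ι} (hx : x ∉ ({o, z} : Finset ι)ᶜ) :
      N.flow h k x y * (-d x - -d y) = 0 := by
    by_cases hxy : N.w x y = 0
    · simp [flow, hxy]
    · rw [Finset.notMem_compl, Finset.mem_insert, Finset.mem_singleton] at hx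
      rcases hx with rfl | rfl
      · rw [hdo y hxy, sub_self, mul_zero]
      · rw [hdz y hxy, sub_self, mul_zero]
  have hedge (x y : ι) : N.flow h k x y * (-d x - -d y) ≤ |N.flow h k x y| := by
    by_cases hxy : N.w x y = 0
    · simp [flow, hxy]
    · refine (le_abs_self _).trans ?_
      rw [abs_mul, neg_sub_neg, abs_sub_comm]
      exact mul_le_of_le_one_right (abs_nonneg _) (hd x y hxy)
  calc 2 * ((∑ y, N.flow h k o y) * (d z - d o))
      = ∑ x, ∑ y, N.flow h k x y * (-d x - -d y) := by
        rw [sum_sum_flow_mul_sub flow_antisymm hoz (hh.sum_flow_eq_zero hk) fun x => -d x]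
        ring
    _ = ∑ x ∈ {o, z}ᶜ, ∑ y, N.flow h k x y * (-d x - -d y) :=
        (Finset.sum_subset (Finset.subset_univ _) fun x _ hx =>
          Finset.sum_eq_zero fun y _ => hboundary hx).symm
    _ ≤ _ := Finset.sum_le_sum fun x _ => Finset.sum_le_sum fun y _ => hedge x y

/- The flow from `o` to `z` has to cross the distance, which Pinsker's inequality bounds by the
entropy produced along the way; that entropy telescopes to `-log (h o)` and `-log (k z)`. -/
theorem two_mul_log_mul_sq_le (hh : N.IsDiscounted m z h) (hk : N.IsDiscounted m o k)
    (hm : 1 < m) (hoz : o ≠ z) (hho : 0 < h o) (hWo : 0 < N.W o) {d : ι → ℝ}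
    (hd : ∀ x y, N.w x y ≠ 0 → |d x - d y| ≤ 1) (hdo : ∀ y, N.w o y ≠ 0 → d y = d o)
    (hdz : ∀ y, N.w z y ≠ 0 → d y = d z) (hle : d o ≤ d z) :
    2 * Real.log m * (d z - d o) ^ 2 ≤ (-Real.log (h o) + 1) * (-Real.log (k z) + 1) := by
  classical
  set J := ∑ y, N.flow h k o y with hJ
  have hJpos : 0 < J := by
    rw [hJ, hh.sum_flow_source hk hoz]
    have := lt_mul_of_one_lt_left hWo hm
    exact mul_pos hho (by linarith [hk.sum_mul_le o])
  have hlog := Real.log_pos hm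
  have hdist := hh.two_mul_sum_flow_mul_le hk hoz hd hdo hdz
  have hsq := mul_le_mul_of_nonneg_left
    (pow_le_pow_left₀ (by have := sub_nonneg.2 hle; positivity) hdist 2) (half_pos hlog).le
  have := hsq.trans (hh.sq_sum_compl_pair_abs_flow_le hk hm hoz)
  refine le_of_mul_le_mul_left ?_ (pow_pos hJpos 2)
  linarith

end IsDiscounted

end KilledNetwork

section Asymptotics

theorem tendsto_log_natCast_atTop : Tendsto (fun n : ℕ => Real.log n) atTop atTop :=
  Real.tendsto_log_atTop.comp tendsto_natCast_atTop_atTop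

theorem tendsto_const_div_log (a : ℝ) : Tendsto (fun n : ℕ => a / Real.log n) atTop (𝓝 0) :=
  tendsto_const_nhds.div_atTop tendsto_log_natCast_atTop

theorem tendsto_log_div_natCast : Tendsto (fun n : ℕ => Real.log n / n) atTop (𝓝 0) :=
  Real.isLittleO_log_id_atTop.tendsto_div_nhds_zero.comp tendsto_natCast_atTop_atTop

theorem tendsto_log_log_div_log :
    Tendsto (fun n : ℕ => Real.log (Real.log n) / Real.log n) atTop (𝓝 0) :=
  Real.isLittleO_log_id_atTop.tendsto_div_nhds_zero.comp tendsto_log_natCast_atTop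

theorem eventually_natCast_pos_and_log_pos :
    ∀ᶠ n : ℕ in atTop, 0 < (n : ℝ) ∧ 0 < Real.log n :=
  (tendsto_natCast_atTop_atTop.eventually_gt_atTop 0).and
    (tendsto_log_natCast_atTop.eventually_gt_atTop 0)

theorem tendsto_natCast_rpow_neg {x : ℝ} (hx : 0 < x) :
    Tendsto (fun n : ℕ => (n : ℝ) ^ (-x)) atTop (𝓝 0) :=
  (tendsto_rpow_neg_atTop hx).comp tendsto_natCast_atTop_atTop

theorem isEquivalent_toReal_of_eventually_le {ι : Type*} {l : Filter ι} {f : ι → ℝ≥0∞} {b : ι → ℝ}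
    {A : ℝ} (hA : 0 < A) (hb : ∀ᶠ i in l, 0 < b i)
    (hup : ∀ a, A < a → ∀ᶠ i in l, f i ≤ ENNReal.ofReal (a * b i))
    (hlow : ∀ a, 0 < a → a < A → ∀ᶠ i in l, ENNReal.ofReal (a * b i) ≤ f i) :
    (fun i => (f i).toReal) ~[l] fun i => A * b i := by
  refine isEquivalent_of_tendsto_one ?_
  have hratio : Tendsto (fun i => (f i).toReal / b i) l (𝓝 A) := by
    refine tendsto_order.2 ⟨fun a ha => ?_, fun a ha => ?_⟩
    · obtain ⟨a', ha', ha'A⟩ := exists_between (max_lt ha hA)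
      obtain ⟨haa', ha'0⟩ := max_lt_iff.1 ha'
      filter_upwards [hb, hlow a' ha'0 ha'A, hup (A + 1) (lt_add_one A)] with i hbi hle hge
      have hle' := (ENNReal.ofReal_le_iff_le_toReal
        (ne_top_of_le_ne_top ENNReal.ofReal_ne_top hge)).1 hle
      exact haa'.trans_le ((le_div_iff₀ hbi).2 hle')
    · obtain ⟨a', hAa', ha'⟩ := exists_between ha
      filter_upwards [hb, hup a' hAa'] with i hbi hle
      have hle' := ENNReal.toReal_le_of_le_ofReal (by nlinarith) hle
      exact ((div_le_iff₀ hbi).2 hle').trans_lt ha'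
  refine (hratio.div_const A).congr' ?_ |>.trans_eq (by rw [div_self hA.ne'])
  filter_upwards with i
  rw [Pi.div_apply, div_div, mul_comm]

theorem abs_log_toReal_div_log_sub_le {n : ℕ} (hn : 0 < (n : ℝ)) (hlog : 0 < Real.log n)
    {x : ℝ≥0∞} {a ε : ℝ} (hup : x ≤ ENNReal.ofReal ((n : ℝ) ^ (a + ε)))
    (hlow : ENNReal.ofReal ((n : ℝ) ^ (a - ε)) ≤ x) :
    |Real.log x.toReal / Real.log n - a| ≤ ε := by
  have htop : x ≠ ⊤ := ne_top_of_le_ne_top ENNReal.ofReal_ne_top hup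
  have hup' := ENNReal.toReal_le_of_le_ofReal (by positivity) hup
  have hlow' := (ENNReal.ofReal_le_iff_le_toReal htop).1 hlow
  have hpos : 0 < x.toReal := lt_of_lt_of_le (by positivity) hlow'
  have hlog_up := Real.log_le_log hpos hup'
  have hlog_low := Real.log_le_log (by positivity) hlow'
  rw [Real.log_rpow hn, ← div_le_iff₀ hlog] at hlog_up
  rw [Real.log_rpow hn, ← le_div_iff₀ hlog] at hlog_low
  exact abs_le.2 ⟨by linarith, by linarith⟩

theorem ofReal_natCast_rpow_log_toReal_div_log {n : ℕ} (hn : 0 < (n : ℝ)) (hlog : 0 < Real.log n)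
    {x : ℝ≥0∞} (h0 : x ≠ 0) (htop : x ≠ ⊤) :
    ENNReal.ofReal ((n : ℝ) ^ (Real.log x.toReal / Real.log n)) = x := by
  rw [Real.rpow_def_of_pos hn, mul_div_cancel₀ _ hlog.ne',
    Real.exp_log (ENNReal.toReal_pos h0 htop), ENNReal.ofReal_toReal htop]

theorem exists_tendsto_zero_eventually_eq_rpow {S : ℕ → ℝ≥0∞} {a : ℝ}
    (hup : ∀ ε > 0, ∀ᶠ n : ℕ in atTop, S n ≤ ENNReal.ofReal ((n : ℝ) ^ (a + ε)))
    (hlow : ∀ ε > 0, ∀ᶠ n : ℕ in atTop, ENNReal.ofReal ((n : ℝ) ^ (a - ε)) ≤ S n) :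
    ∃ ε : ℕ → ℝ, Tendsto ε atTop (𝓝 0) ∧
      ∀ᶠ n : ℕ in atTop, S n = ENNReal.ofReal ((n : ℝ) ^ (a + ε n)) := by
  refine ⟨fun n => Real.log (S n).toReal / Real.log n - a, ?_, ?_⟩
  · refine Metric.tendsto_nhds.2 fun ε hε => ?_
    filter_upwards [hup _ (half_pos hε), hlow _ (half_pos hε),
      eventually_natCast_pos_and_log_pos] with n hle hge ⟨hn, hlog⟩
    rw [Real.dist_0_eq_abs]
    exact (abs_log_toReal_div_log_sub_le hn hlog hle hge).trans_lt (half_lt_self hε)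
  · filter_upwards [hup 1 one_pos, hlow 1 one_pos,
      eventually_natCast_pos_and_log_pos] with n hle hge ⟨hn, hlog⟩
    have hpos : 0 < S n := (ENNReal.ofReal_pos.2 (by positivity)).trans_le hge
    rw [add_sub_cancel, ofReal_natCast_rpow_log_toReal_div_log hn hlog hpos.ne'
      (ne_top_of_le_ne_top ENNReal.ofReal_ne_top hle)]

theorem ofReal_exp_mul_le_ofReal_rpow {n : ℕ} (hn : 1 ≤ n) {a b d : ℝ} {x : ℝ≥0∞}
    (hx : x ≤ ENNReal.ofReal ((n : ℝ) ^ a)) (hab : b + a ≤ d) :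
    ENNReal.ofReal (Real.exp (Real.log n * b)) * x ≤ ENNReal.ofReal ((n : ℝ) ^ d) := by
  have hn' : (0 : ℝ) < n := by positivity
  refine (mul_le_mul_right hx _).trans ?_
  rw [← Real.rpow_def_of_pos hn', ← ENNReal.ofReal_mul (by positivity), ← Real.rpow_add hn']
  exact ENNReal.ofReal_le_ofReal
    (Real.rpow_le_rpow_of_exponent_le (by exact_mod_cast hn) hab)

theorem le_of_three_mul_le_add_add {Y B : ℝ≥0∞} (hY : Y ≠ ⊤) (h : 3 * Y ≤ Y + B + Y) : Y ≤ B := by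
  refine (ENNReal.add_le_add_iff_right (ENNReal.add_ne_top.2 ⟨hY, hY⟩)).1 ?_
  calc Y + (Y + Y) = 3 * Y := by ring
    _ ≤ Y + B + Y := h
    _ = B + (Y + Y) := by ring

theorem exists_lt_chord {f : ℝ → ℝ} {f' a b r x : ℝ} (hf : HasDerivAt f f' x) (ha : a < f')
    (hb : f' < b) (hr : 0 < r) :
    ∃ ϑ, 0 < ϑ ∧ ϑ < r ∧ f x + ϑ * a < f (x + ϑ) ∧ f x - ϑ * b < f (x - ϑ) := by
  have hslope := hasDerivAt_iff_tendsto_slope_zero.1 hf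
  have hright : ∀ᶠ ϑ in 𝓝[>] (0 : ℝ), a < ϑ⁻¹ • (f (x + ϑ) - f x) :=
    (hslope.mono_left (nhdsGT_le_nhdsNE 0)).eventually_const_lt ha
  have hneg : Tendsto (fun ϑ : ℝ => -ϑ) (𝓝[>] 0) (𝓝[≠] 0) :=
    (tendsto_neg_nhdsGT (a := (0 : ℝ))).mono_right (by simpa using nhdsLT_le_nhdsNE (0 : ℝ))
  have hleft : ∀ᶠ ϑ in 𝓝[>] (0 : ℝ), (-ϑ)⁻¹ • (f (x + -ϑ) - f x) < b :=
    (hslope.comp hneg).eventually_lt_const hb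
  obtain ⟨ϑ, h₁, h₂, hϑ, hϑr⟩ := (hright.and (hleft.and (Ioo_mem_nhdsGT hr))).exists
  rw [smul_eq_mul, lt_inv_mul_iff₀ hϑ] at h₁
  rw [inv_neg, smul_eq_mul, neg_mul, ← mul_neg, inv_mul_lt_iff₀ hϑ, ← sub_eq_add_neg] at h₂
  exact ⟨ϑ, hϑ, hϑr, by linarith, by linarith⟩

theorem tendsto_exp_sub_one_div :
    Tendsto (fun x : ℝ => (Real.exp x - 1) / x) (𝓝[≠] 0) (𝓝 1) := by
  simpa [div_eq_inv_mul] using hasDerivAt_iff_tendsto_slope_zero.1 (Real.hasDerivAt_exp 0)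

theorem tendsto_one_add_const_mul_log_div (σ : ℝ) :
    Tendsto (fun n : ℕ => 1 + σ * (Real.log n / n)) atTop (𝓝 1) := by
  simpa using (tendsto_log_div_natCast.const_mul σ).const_add 1

theorem one_add_const_mul_log_div_pow_le {σ : ℝ} (hσ : 0 ≤ σ) {n : ℕ} (hn : 0 < n) :
    (1 + σ * (Real.log n / n)) ^ (n - 1) ≤ (n : ℝ) ^ σ := by
  have hn' : (0 : ℝ) < n := by positivity
  calc (1 + σ * (Real.log n / n)) ^ (n - 1) ≤ (1 + σ * (Real.log n / n)) ^ n :=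
        pow_le_pow_right₀ (le_add_of_nonneg_right (by positivity)) (n.sub_le 1)
    _ ≤ Real.exp (σ * (Real.log n / n)) ^ n := by
        gcongr
        exact (add_comm _ _).trans_le (Real.add_one_le_exp _)
    _ = (n : ℝ) ^ σ := by
        rw [← Real.exp_nat_mul, Real.rpow_def_of_pos hn']
        field_simp

/-- The killing rate `ℓ (log n / n) ^ 2`, at which the Laplace transform of the hitting time decays
like a power of `n`. -/
noncomputable def killRate (ℓ : ℝ) (n : ℕ) : ℝ := ℓ * (Real.log n / n) ^ 2

theorem eventually_killRate_pos {ℓ : ℝ} (hℓ : 0 < ℓ) : ∀ᶠ n : ℕ in atTop, 0 < killRate ℓ n := by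
  filter_upwards [eventually_natCast_pos_and_log_pos] with n ⟨hn, hlog⟩
  unfold killRate
  positivity

theorem tendsto_killRate (ℓ : ℝ) : Tendsto (killRate ℓ) atTop (𝓝 0) :=
  ((tendsto_log_div_natCast.pow 2).const_mul ℓ).trans_eq (by norm_num)

theorem tendsto_killRate_nhdsNE {ℓ : ℝ} (hℓ : 0 < ℓ) : Tendsto (killRate ℓ) atTop (𝓝[≠] 0) :=
  tendsto_nhdsWithin_iff.2 ⟨tendsto_killRate ℓ,
    (eventually_killRate_pos hℓ).mono fun _ h => h.ne'⟩

theorem log_killRate {ℓ : ℝ} (hℓ : 0 < ℓ) {n : ℕ} (hn : 0 < (n : ℝ)) (hlog : 0 < Real.log n) :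
    Real.log (killRate ℓ n) = Real.log ℓ + 2 * (Real.log (Real.log n) - Real.log n) := by
  rw [killRate, Real.log_mul hℓ.ne' (by positivity), Real.log_pow,
    Real.log_div hlog.ne' hn.ne', Nat.cast_ofNat]

theorem killRate_mul (ℓ α : ℝ) {n : ℕ} (hn : 0 < (n : ℝ)) (hlog : 0 < Real.log n) :
    killRate ℓ n * (α * (n : ℝ) ^ 2 / Real.log n) = Real.log n * (ℓ * α) := by
  unfold killRate
  field_simp

theorem killRate_add (ℓ ϑ : ℝ) (n : ℕ) : killRate (ℓ + ϑ) n = killRate ℓ n + killRate ϑ n :=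
  add_mul _ _ _

theorem killRate_sub (ℓ ϑ : ℝ) (n : ℕ) : killRate (ℓ - ϑ) n = killRate ℓ n - killRate ϑ n :=
  sub_mul _ _ _

theorem tendsto_exp_killRate_sub_one_div {ℓ : ℝ} (hℓ : 0 < ℓ) :
    Tendsto (fun n : ℕ => (Real.exp (killRate ℓ n) - 1) / (Real.log n / n) ^ 2) atTop (𝓝 ℓ) := by
  have hlim := (tendsto_exp_sub_one_div.comp (tendsto_killRate_nhdsNE hℓ)).const_mul ℓ
  rw [mul_one] at hlim
  refine hlim.congr' ?_
  filter_upwards [eventually_natCast_pos_and_log_pos] with n ⟨hn, hlog⟩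
  simp only [Function.comp_apply]
  nth_rw 2 [killRate]
  field_simp

theorem log_mul_exp_div_exp_sub_one {R l : ℝ} (hR : 0 < R) (hl : 0 < l) :
    Real.log (R * Real.exp l / (Real.exp l - 1)) =
      Real.log R + l - Real.log ((Real.exp l - 1) / l) - Real.log l := by
  have hexp : 0 < Real.exp l - 1 := sub_pos.2 (Real.one_lt_exp_iff.2 hl)
  rw [Real.log_div (by positivity) hexp.ne', Real.log_mul hR.ne' (Real.exp_ne_zero l),
    Real.log_exp, Real.log_div hexp.ne' hl.ne']
  ring

theorem tendsto_log_weight_div_log {c ℓ : ℝ} (p : ℝ) (hc : 0 < c) (hℓ : 0 < ℓ) :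
    Tendsto (fun n : ℕ => Real.log (c * (n : ℝ) ^ p * Real.exp (killRate ℓ n) /
      (Real.exp (killRate ℓ n) - 1)) / Real.log n) atTop (𝓝 (p + 2)) := by
  have hquot : Tendsto (fun n => Real.log ((Real.exp (killRate ℓ n) - 1) / killRate ℓ n))
      atTop (𝓝 (Real.log 1)) :=
    (Real.continuousAt_log one_ne_zero).tendsto.comp
      (tendsto_exp_sub_one_div.comp (tendsto_killRate_nhdsNE hℓ))
  have hconst := tendsto_const_div_log (Real.log c - Real.log ℓ)
  have hkill := (tendsto_killRate ℓ).div_atTop tendsto_log_natCast_atTop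
  have hlim := (((hconst.add hkill).sub (hquot.div_atTop tendsto_log_natCast_atTop)).sub
    (tendsto_log_log_div_log.const_mul 2)).add_const (p + 2)
  simp only [mul_zero, add_zero, sub_zero, zero_add] at hlim
  refine hlim.congr' ?_
  filter_upwards [eventually_natCast_pos_and_log_pos, eventually_killRate_pos hℓ]
    with n ⟨hn, hlog⟩ hk
  rw [log_mul_exp_div_exp_sub_one (by positivity) hk, log_killRate hℓ hn hlog,
    Real.log_mul hc.ne' (by positivity), Real.log_rpow hn]
  field_simp
  ring

/-- The exponent of decay of the Laplace transform at the killing rate `killRate ℓ n`, where `q`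
stands for `(p + 2) / 2`. -/
noncomputable def laplaceExponent (q ℓ : ℝ) : ℝ := √(q ^ 2 + 2 * ℓ) - q

theorem laplaceExponent_nonneg (q : ℝ) {ℓ : ℝ} (hℓ : 0 ≤ ℓ) : 0 ≤ laplaceExponent q ℓ :=
  sub_nonneg.2 (Real.le_sqrt_of_sq_le (by linarith))

/-- The killing rate at which the Laplace transform gives the sharp bound for the probability of
hitting before time `β n ^ 2 / log n`. -/
noncomputable def dualRate (q β : ℝ) : ℝ := ((1 / β) ^ 2 - q ^ 2) / 2

section DualRate

variable {q β : ℝ}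

theorem dualRate_pos (hq : 0 ≤ q) (hβ : 0 < β) (h : β * q < 1) : 0 < dualRate q β := by
  have : q ^ 2 < (1 / β) ^ 2 := by
    gcongr
    rwa [lt_div_iff₀' hβ]
  unfold dualRate
  linarith

theorem sq_add_two_mul_dualRate (q β : ℝ) : q ^ 2 + 2 * dualRate q β = (1 / β) ^ 2 := by
  unfold dualRate
  ring

theorem laplaceExponent_dualRate (q : ℝ) (hβ : 0 < β) :
    laplaceExponent q (dualRate q β) = 1 / β - q := by
  rw [laplaceExponent, sq_add_two_mul_dualRate, Real.sqrt_sq (by positivity)]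

theorem hasDerivAt_laplaceExponent_dualRate (q : ℝ) (hβ : 0 < β) :
    HasDerivAt (laplaceExponent q) β (dualRate q β) := by
  have hlin : HasDerivAt (fun ℓ => q ^ 2 + 2 * ℓ) 2 (dualRate q β) := by
    simpa using ((hasDerivAt_id (dualRate q β)).const_mul 2).const_add (q ^ 2)
  have h := (hlin.sqrt (by rw [sq_add_two_mul_dualRate]; positivity)).sub_const q
  rw [sq_add_two_mul_dualRate, Real.sqrt_sq (by positivity)] at h
  refine h.congr_deriv ?_
  field_simp

theorem dualRate_mul_sub_laplaceExponent (p : ℝ) {α : ℝ} (hα : 0 < α) :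
    dualRate ((p + 2) / 2) α * α - laplaceExponent ((p + 2) / 2) (dualRate ((p + 2) / 2) α) =
      -(α * (p + 2) - 2) ^ 2 / (8 * α) := by
  rw [laplaceExponent_dualRate _ hα, dualRate]
  field_simp
  ring

theorem tendsto_dualRate_mul_sub_laplaceExponent (p : ℝ) {α : ℝ} (hα : 0 < α) :
    Tendsto (fun t => dualRate ((p + 2) / 2) (α - t) * (α - 2 * t) -
      laplaceExponent ((p + 2) / 2) (dualRate ((p + 2) / 2) (α - t))) (𝓝 0)
      (𝓝 (-(α * (p + 2) - 2) ^ 2 / (8 * α))) := by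
  have hinv : ContinuousAt (fun t => 1 / (α - t)) 0 :=
    continuousAt_const.div (by fun_prop) (by simpa using hα.ne')
  have hcont : ContinuousAt (fun t => dualRate ((p + 2) / 2) (α - t) * (α - 2 * t) -
      laplaceExponent ((p + 2) / 2) (dualRate ((p + 2) / 2) (α - t))) 0 := by
    unfold laplaceExponent dualRate
    fun_prop
  refine hcont.tendsto.trans_eq ?_
  rw [mul_zero, sub_zero, dualRate_mul_sub_laplaceExponent p hα]

end DualRate

end Asymptotics

theorem lintegral_pmf_toMeasure {α : Type*} [MeasurableSpace α] [DiscreteMeasurableSpace α]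
    (p : PMF α) (f : α → ℝ≥0∞) : ∫⁻ y, f y ∂p.toMeasure = ∑' y, p y * f y := by
  rw [← PMF.restrict_toMeasure_support, lintegral_countable _ p.support_countable]
  simp_rw [PMF.toMeasure_apply_singleton _ _ MeasurableSet.of_discrete]
  rw [tsum_subtype p.support fun y => f y * p y]
  refine tsum_congr fun y => ?_
  by_cases hy : y ∈ p.support
  · rw [Set.indicator_of_mem hy, mul_comm]
  · rw [Set.indicator_of_notMem hy, (p.apply_eq_zero_iff y).2 hy, zero_mul]

namespace WeightedGraph

section Avoid

variable {V : Type u} (z : Set V) (k : ℕ)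

/-- The event that a trajectory avoids `z` up to time `k`. -/
def avoid : Set (ℕ → V) := {ω | ∀ i ≤ k, ω i ∉ z}

theorem avoid_succ : avoid z (k + 1) = avoid z k ∩ {ω | ω (k + 1) ∉ z} := by
  ext ω
  simp only [avoid, Nat.le_succ_iff, Set.mem_ofPred_eq, Set.mem_inter_iff, or_imp, forall_and,
    forall_eq]

theorem compl_avoid_succ :
    (avoid z (k + 1))ᶜ = (avoid z k)ᶜ ∪ avoid z k ∩ {ω | ω (k + 1) ∈ z} := by
  rw [avoid_succ]
  ext ω
  simp only [Set.mem_compl_iff, Set.mem_inter_iff, Set.mem_ofPred_eq, Set.mem_union]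
  tauto

theorem measurableSet_avoid [MeasurableSpace V] [DiscreteMeasurableSpace V] :
    MeasurableSet (avoid z k) := by
  have : avoid z k = ⋂ i ∈ Set.Iic k, (fun ω : ℕ → V => ω i) ⁻¹' zᶜ := by
    ext ω
    simp [avoid]
  rw [this]
  exact MeasurableSet.biInter (Set.to_countable _) fun i _ =>
    measurable_pi_apply i MeasurableSet.of_discrete

variable {z} {ω : ℕ → V}

theorem hitTime_lt_iff {t : ℝ≥0∞} : hitTime z ω < t ↔ ∃ k : ℕ, ω k ∈ z ∧ (k : ℝ≥0∞) < t := by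
  simp [hitTime, iInf_lt_iff]

theorem setOf_hitTime_lt_natCast_succ : {ω | hitTime z ω < ((k + 1 : ℕ) : ℝ≥0∞)} =
    (avoid z k)ᶜ := by
  ext ω
  simp only [Set.mem_ofPred_eq, hitTime_lt_iff, Nat.cast_lt, Nat.lt_succ_iff, avoid,
    Set.mem_compl_iff, not_forall, not_not, exists_prop, and_comm]

theorem measurable_hitTime [MeasurableSpace V] [DiscreteMeasurableSpace V] :
    Measurable (hitTime z) :=
  Measurable.iInf fun k =>
    (Measurable.of_discrete (f := fun x : V => ⨅ _ : x ∈ z, (k : ℝ≥0∞))).comp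
      (measurable_pi_apply k)

theorem hitTime_le_tsum_indicator_avoid : hitTime z ω ≤ ∑' k, (avoid z k).indicator 1 ω := by
  classical
  by_cases h : ∃ k, ω k ∈ z
  · have havoid (k : ℕ) (hk : k ∈ Finset.range (Nat.find h)) : ω ∈ avoid z k := fun i hi =>
      Nat.find_min h (hi.trans_lt (Finset.mem_range.1 hk))
    calc hitTime z ω ≤ Nat.find h := iInf₂_le (Nat.find h) (Nat.find_spec h)
      _ = ∑ k ∈ Finset.range (Nat.find h), (avoid z k).indicator 1 ω := by
          rw [Finset.sum_congr rfl fun k hk => Set.indicator_of_mem (havoid k hk) _]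
          simp
      _ ≤ _ := ENNReal.sum_le_tsum _
  · push Not at h
    have havoid (k : ℕ) : ω ∈ avoid z k := fun i _ => h i
    simp [Set.indicator_of_mem (havoid _)]

end Avoid

variable {V : Type u} (G : WeightedGraph V)

/-- The mean of a function after one step of the walk from `x`. -/
noncomputable def stepMean (f : V → ℝ≥0∞) (x : V) : ℝ≥0∞ := ∑' y, G.step x y * f y

/-- The transition operator of the walk killed on arrival in `z`. -/
noncomputable def killed (z : Set V) (f : V → ℝ≥0∞) : V → ℝ≥0∞ := G.stepMean (zᶜ.indicator f)

/-- The probability that the walk started at `x ∉ z` first visits `z` at time `k + 1`. -/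
noncomputable def hitAt (z : Set V) (k : ℕ) : V → ℝ≥0∞ :=
  (G.killed z)^[k] (G.stepMean (z.indicator 1))

section WalkLaw

variable [MeasurableSpace V] [DiscreteMeasurableSpace V]

instance (o : V) : IsProbabilityMeasure (G.walkLaw o) := by
  unfold walkLaw
  infer_instance

theorem lintegral_stepKernel (f : V → ℝ≥0∞) (x : V) :
    ∫⁻ y, f y ∂(G.stepKernel x) = G.stepMean f x := lintegral_pmf_toMeasure _ f

theorem lintegral_walkLaw_succ (o : V) (n : ℕ) {g : (Finset.Iic n → V) → ℝ≥0∞}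
    (hg : Measurable g) (F : V → ℝ≥0∞) :
    ∫⁻ ω, g (Preorder.frestrictLe (π := fun _ => V) n ω) * F (ω (n + 1)) ∂(G.walkLaw o) =
      ∫⁻ ω, g (Preorder.frestrictLe (π := fun _ => V) n ω) * G.stepMean F (ω n)
        ∂(G.walkLaw o) := by
  set past := Kernel.partialTraj (X := fun _ => V) G.pastKernel 0 n (fun _ => o)
  have hpast : (G.walkLaw o).map (Preorder.frestrictLe n) = past :=
    Kernel.traj_map_frestrictLe_apply 0 n _
  have hF : Measurable F := Measurable.of_discrete
  have hmeas : Measurable fun q : (Finset.Iic n → V) × V => g q.1 * F q.2 :=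
    (hg.comp measurable_fst).mul (hF.comp measurable_snd)
  calc _ = ∫⁻ q, g q.1 * F q.2 ∂((G.walkLaw o).map
        fun x => (Preorder.frestrictLe (π := fun _ => V) n x, x (n + 1))) := by
        rw [lintegral_map hmeas (by fun_prop)]
    _ = ∫⁻ x, ∫⁻ y, g x * F y ∂(G.pastKernel n x) ∂past := by
        rw [walkLaw, ← Kernel.partialTraj_compProd_eq_map_traj (Nat.zero_le n),
          Measure.lintegral_compProd hmeas]
    _ = ∫⁻ x, g x * G.stepMean F (x ⟨n, Finset.mem_Iic.2 le_rfl⟩) ∂past := by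
        refine lintegral_congr fun x => ?_
        rw [lintegral_const_mul _ hF]
        exact congrArg _ (G.lintegral_stepKernel F _)
    _ = _ := by
        rw [← hpast, lintegral_map _ (by fun_prop)]
        · rfl
        · exact hg.mul ((Measurable.of_discrete (f := G.stepMean F)).comp (measurable_pi_apply _))

theorem ae_walkLaw_zero (o : V) : ∀ᵐ ω ∂(G.walkLaw o), ω 0 = o := by
  have hmap := Kernel.traj_map_frestrictLe_apply (X := fun _ => V) (κ := G.pastKernel) 0 0
    (fun _ => o)
  rw [Kernel.partialTraj_self, Kernel.id_apply] at hmap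
  have hdirac : ∀ᵐ x ∂(Measure.dirac (fun _ : Finset.Iic 0 => o)),
      x ⟨0, Finset.mem_Iic.2 le_rfl⟩ = o := by
    rw [ae_dirac_iff]
    exact measurable_pi_apply (X := fun _ => V) _ (MeasurableSet.of_discrete (s := {o}))
  rw [← hmap] at hdirac
  exact ae_of_ae_map (by fun_prop) hdirac

variable {o : V} {z : Set V}

theorem lintegral_indicator_avoid_succ (o : V) (z : Set V) (k : ℕ) (F : V → ℝ≥0∞) :
    ∫⁻ ω, (avoid z k).indicator 1 ω * F (ω (k + 1)) ∂(G.walkLaw o) =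
      ∫⁻ ω, (avoid z k).indicator 1 ω * G.stepMean F (ω k) ∂(G.walkLaw o) := by
  let S : Set (Finset.Iic k → V) := {x | ∀ i, x i ∉ z}
  have hS : MeasurableSet S := by
    have : S = ⋂ i, (fun x : Finset.Iic k → V => x i) ⁻¹' zᶜ := by
      ext
      simp [S]
    rw [this]
    exact MeasurableSet.iInter fun i => measurable_pi_apply i MeasurableSet.of_discrete
  have hpre : avoid z k = Preorder.frestrictLe (π := fun _ => V) k ⁻¹' S := by
    ext
    simp [S, avoid]
  rw [hpre]
  exact G.lintegral_walkLaw_succ o k (measurable_one.indicator hS) F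

theorem lintegral_indicator_avoid (ho : o ∉ z) (k : ℕ) (F : V → ℝ≥0∞) :
    ∫⁻ ω, (avoid z k).indicator 1 ω * F (ω k) ∂(G.walkLaw o) = (G.killed z)^[k] F o := by
  induction k generalizing F with
  | zero =>
    calc ∫⁻ ω, (avoid z 0).indicator 1 ω * F (ω 0) ∂(G.walkLaw o)
        = ∫⁻ _, F o ∂(G.walkLaw o) := by
          refine lintegral_congr_ae ?_
          filter_upwards [G.ae_walkLaw_zero o] with ω hω
          have : ω ∈ avoid z 0 := fun i hi => by rwa [Nat.le_zero.1 hi, hω]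
          simp [Set.indicator_of_mem this, hω]
      _ = _ := by simp
  | succ k ih =>
    rw [Function.iterate_succ_apply, ← ih, killed, ← G.lintegral_indicator_avoid_succ]
    refine lintegral_congr fun ω => ?_
    rw [avoid_succ]
    by_cases h1 : ω ∈ avoid z k <;> by_cases h2 : ω (k + 1) ∈ z <;> simp [Set.indicator, h1, h2]

theorem walkLaw_avoid (ho : o ∉ z) (k : ℕ) : G.walkLaw o (avoid z k) = (G.killed z)^[k] 1 o := by
  rw [← G.lintegral_indicator_avoid ho, ← lintegral_indicator_one (measurableSet_avoid z k)]
  simp only [Pi.one_apply, mul_one]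

theorem walkLaw_avoid_inter (ho : o ∉ z) (k : ℕ) :
    G.walkLaw o (avoid z k ∩ {ω | ω (k + 1) ∈ z}) = G.hitAt z k o := by
  have hmeas : MeasurableSet (avoid z k ∩ {ω | ω (k + 1) ∈ z}) :=
    (measurableSet_avoid z k).inter (measurable_pi_apply (k + 1) MeasurableSet.of_discrete)
  rw [hitAt, ← G.lintegral_indicator_avoid ho, ← G.lintegral_indicator_avoid_succ,
    ← lintegral_indicator_one hmeas]
  refine lintegral_congr fun ω => ?_
  by_cases h1 : ω ∈ avoid z k <;> by_cases h2 : ω (k + 1) ∈ z <;> simp [Set.indicator, h1, h2]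

theorem walkLaw_compl_avoid (ho : o ∉ z) (k : ℕ) :
    G.walkLaw o (avoid z k)ᶜ = ∑ i ∈ Finset.range k, G.hitAt z i o := by
  induction k with
  | zero =>
    rw [prob_compl_eq_one_sub (measurableSet_avoid z 0), G.walkLaw_avoid ho]
    simp
  | succ k ih =>
    have hmeas : MeasurableSet (avoid z k ∩ {ω | ω (k + 1) ∈ z}) :=
      (measurableSet_avoid z k).inter (measurable_pi_apply (k + 1) MeasurableSet.of_discrete)
    rw [compl_avoid_succ, measure_union _ hmeas, ih, Finset.sum_range_succ,
      G.walkLaw_avoid_inter ho]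
    exact Set.disjoint_left.2 fun ω h1 h2 => h1 h2.1

theorem probHitBefore_eq (ho : o ∉ z) (t : ℝ) :
    G.probHitBefore o z t = ∑ k ∈ Finset.range (⌈t⌉₊ - 1), G.hitAt z k o := by
  have hceil (ω : ℕ → V) : hitTime z ω < ENNReal.ofReal t ↔ hitTime z ω < (⌈t⌉₊ : ℝ≥0∞) := by
    have (k : ℕ) : (k : ℝ≥0∞) < ENNReal.ofReal t ↔ k < ⌈t⌉₊ := by
      rw [Nat.lt_ceil, ← ENNReal.ofReal_natCast,
        ENNReal.ofReal_lt_ofReal_iff_of_nonneg (Nat.cast_nonneg k)]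
    simp only [hitTime_lt_iff, this, Nat.cast_lt]
  simp only [probHitBefore, hceil]
  rcases ⌈t⌉₊.eq_zero_or_eq_succ_pred with h0 | hsucc
  · simp [h0]
  · rw [hsucc, setOf_hitTime_lt_natCast_succ, G.walkLaw_compl_avoid ho]
    rfl

theorem expectedHit_le_tsum_killed (ho : o ∉ z) :
    G.expectedHit o z ≤ ∑' k, (G.killed z)^[k] 1 o :=
  calc G.expectedHit o z ≤ ∫⁻ ω, ∑' k, (avoid z k).indicator 1 ω ∂(G.walkLaw o) :=
        lintegral_mono fun _ => hitTime_le_tsum_indicator_avoid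
    _ = ∑' k, ∫⁻ ω, (avoid z k).indicator 1 ω ∂(G.walkLaw o) :=
        lintegral_tsum fun k => (measurable_one.indicator (measurableSet_avoid z k)).aemeasurable
    _ = _ := tsum_congr fun k => by
        rw [lintegral_indicator_one (measurableSet_avoid z k), G.walkLaw_avoid ho]

variable (o z) in
theorem ofReal_mul_one_sub_probHitBefore_le_expectedHit (t : ℝ) :
    ENNReal.ofReal t * (1 - G.probHitBefore o z t) ≤ G.expectedHit o z := by
  refine le_trans ?_ (mul_meas_ge_le_lintegral₀ measurable_hitTime.aemeasurable
    (ENNReal.ofReal t))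
  rw [probHitBefore, ← prob_compl_eq_one_sub (measurableSet_lt measurable_hitTime
    measurable_const)]
  simp only [Set.compl_ofPred, not_lt, le_refl]

end WalkLaw

section Laplace

variable {z : Set V} {x : V}

theorem killed_eq_tsum (f : V → ℝ≥0∞) (x : V) :
    G.killed z f x = ∑' y : ↥zᶜ, G.step x y * f y := by
  rw [tsum_subtype zᶜ fun y => G.step x y * f y, killed, stepMean]
  simp only [← Set.indicator_mul_right]

theorem killed_sum {ι : Type*} (s : Finset ι) (c : ι → ℝ≥0∞) (f : ι → V → ℝ≥0∞) (x : V) :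
    G.killed z (fun y => ∑ i ∈ s, c i * f i y) x = ∑ i ∈ s, c i * G.killed z (f i) x := by
  simp only [killed_eq_tsum, ← ENNReal.tsum_mul_left]
  rw [← Summable.tsum_finsetSum fun _ _ => ENNReal.summable]
  simp only [Finset.mul_sum, mul_left_comm]

variable (z) in
theorem hitAt_succ (k : ℕ) : G.hitAt z (k + 1) = G.killed z (G.hitAt z k) :=
  Function.iterate_succ_apply' _ _ _

/-- The Laplace transform `E_x[γ ^ T; T ≤ N]` of the hitting time `T` of `z`, for `x ∉ z`. -/
noncomputable def laplace (z : Set V) (γ : ℝ≥0∞) (N : ℕ) (x : V) : ℝ≥0∞ :=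
  ∑ k ∈ Finset.range N, γ ^ (k + 1) * G.hitAt z k x

theorem laplace_succ (γ : ℝ≥0∞) (N : ℕ) (x : V) :
    G.laplace z γ (N + 1) x =
      γ * (G.stepMean (z.indicator 1) x + G.killed z (G.laplace z γ N) x) := by
  have hkilled : G.killed z (G.laplace z γ N) x =
      ∑ k ∈ Finset.range N, γ ^ (k + 1) * G.hitAt z (k + 1) x := by
    simp only [hitAt_succ]
    exact G.killed_sum _ (fun k => γ ^ (k + 1)) (G.hitAt z) x
  rw [hkilled, laplace, Finset.sum_range_succ', add_comm, mul_add, Finset.mul_sum]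
  congr 1
  · simp [hitAt]
  · exact Finset.sum_congr rfl fun k _ => by ring

/-- The variant of `laplace` for the walk that is killed when it leaves the finite set `S`. -/
noncomputable def truncLaplace (γ : ℝ≥0∞) (S : Finset ↥zᶜ) : ℕ → V → ℝ≥0∞
  | 0 => 0
  | N + 1 => fun x =>
    γ * (G.stepMean (z.indicator 1) x + ∑ y ∈ S, G.step x y * truncLaplace γ S N y)

theorem truncLaplace_mono (γ : ℝ≥0∞) (N : ℕ) (x : V) :
    Monotone fun S : Finset ↥zᶜ => G.truncLaplace γ S N x := by
  induction N generalizing x with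
  | zero => exact monotone_const
  | succ N ih =>
    intro S S' hS
    simp only [truncLaplace]
    gcongr γ * (_ + ?_)
    calc ∑ y ∈ S, G.step x y * G.truncLaplace γ S N y
        ≤ ∑ y ∈ S, G.step x y * G.truncLaplace γ S' N y :=
          Finset.sum_le_sum fun y _ => mul_le_mul_right (ih y hS) _
      _ ≤ _ := Finset.sum_le_sum_of_subset hS

theorem laplace_le_iSup_truncLaplace (γ : ℝ≥0∞) (N : ℕ) (x : V) :
    G.laplace z γ N x ≤ ⨆ S : Finset ↥zᶜ, G.truncLaplace γ S N x := by
  classical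
  induction N generalizing x with
  | zero => simp [laplace]
  | succ N ih =>
    have hmono (y : ↥zᶜ) : Monotone fun S : Finset ↥zᶜ => G.step x y * G.truncLaplace γ S N y :=
      fun S S' hS => mul_le_mul_right (G.truncLaplace_mono γ N y hS) _
    rw [laplace_succ, killed_eq_tsum, ENNReal.tsum_eq_iSup_sum, ENNReal.add_iSup,
      ENNReal.mul_iSup]
    refine iSup_le fun S₀ => ?_
    calc γ * (G.stepMean (z.indicator 1) x + ∑ y ∈ S₀, G.step x y * G.laplace z γ N y)
        ≤ γ * (G.stepMean (z.indicator 1) x +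
            ∑ y ∈ S₀, ⨆ S, G.step x y * G.truncLaplace γ S N y) := by
          simp only [← ENNReal.mul_iSup]
          gcongr with y
          exact ih y
      _ = ⨆ S, γ * (G.stepMean (z.indicator 1) x +
            ∑ y ∈ S₀, G.step x y * G.truncLaplace γ S N y) := by
          rw [ENNReal.finsetSum_iSup_of_monotone hmono, ENNReal.add_iSup, ENNReal.mul_iSup]
      _ ≤ _ := by
          refine iSup_le fun S => le_iSup_of_le (S₀ ∪ S) ?_
          simp only [truncLaplace]
          gcongr γ * (_ + ?_)
          exact (Finset.sum_le_sum fun y _ => hmono y Finset.subset_union_right).trans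
            (Finset.sum_le_sum_of_subset Finset.subset_union_left)

end Laplace

section Collapse

variable {z : Set V} {x y : V}

theorem vertexWeight_ne_top (x : V) : G.vertexWeight x ≠ ⊤ := G.tsum_ne_top x

theorem w_le_vertexWeight (x y : V) : (G.w x y : ℝ≥0∞) ≤ G.vertexWeight x :=
  ENNReal.le_tsum (f := fun y => (G.w x y : ℝ≥0∞)) y

theorem vertexWeight_mul_step (x y : V) : G.vertexWeight x * G.step x y = G.w x y := by
  by_cases hx : G.vertexWeight x = 0
  · have := G.w_le_vertexWeight x y
    rw [hx, nonpos_iff_eq_zero] at this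
    rw [hx, this, zero_mul]
  · have hx' := hx
    rw [vertexWeight] at hx'
    rw [step, dif_neg hx', PMF.normalize_apply, mul_left_comm]
    exact (congrArg _ (ENNReal.mul_inv_cancel hx (G.vertexWeight_ne_top x))).trans (mul_one _)

/-- The total weight of the edges from `x` to `z`. -/
noncomputable def weightTo (z : Set V) (x : V) : ℝ≥0∞ := ∑' y : z, (G.w x y : ℝ≥0∞)

theorem vertexWeight_mul_stepMean_indicator_one (x : V) :
    G.vertexWeight x * G.stepMean (z.indicator 1) x = G.weightTo z x := by
  simp only [stepMean, ← ENNReal.tsum_mul_left, ← mul_assoc, vertexWeight_mul_step]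
  rw [weightTo, tsum_subtype z fun y => (G.w x y : ℝ≥0∞)]
  exact tsum_congr fun y => by by_cases hy : y ∈ z <;> simp [hy]

theorem exists_mem_w_ne_zero (hx : G.weightTo z x ≠ 0) : ∃ y ∈ z, G.w x y ≠ 0 := by
  simpa [weightTo] using hx

theorem weightTo_add_sum_le (S : Finset ↥zᶜ) (x : V) :
    G.weightTo z x + ∑ y ∈ S, (G.w x y : ℝ≥0∞) ≤ G.vertexWeight x := by
  rw [vertexWeight, ← Summable.tsum_add_tsum_compl (s := z) ENNReal.summable ENNReal.summable]
  exact add_le_add_right (ENNReal.sum_le_tsum (f := fun y : ↥zᶜ => (G.w x y : ℝ≥0∞)) S) _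

theorem weightTo_ne_top (x : V) : G.weightTo z x ≠ ⊤ :=
  ne_top_of_le_ne_top (G.vertexWeight_ne_top x) (le_self_add.trans (G.weightTo_add_sum_le ∅ x))

theorem sum_weightTo_le (S : Finset ↥zᶜ) : ∑ x ∈ S, G.weightTo z x ≤ G.setWeight z :=
  calc ∑ x ∈ S, G.weightTo z x ≤ ∑' x : ↥zᶜ, ∑' y : z, (G.w x y : ℝ≥0∞) :=
        ENNReal.sum_le_tsum (f := fun x : ↥zᶜ => G.weightTo z x) S
    _ = ∑' y : z, ∑' x : ↥zᶜ, (G.w y x : ℝ≥0∞) := by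
        rw [ENNReal.tsum_comm]
        simp only [G.symm]
    _ ≤ G.setWeight z := ENNReal.tsum_le_tsum fun y =>
        ENNReal.tsum_comp_le_tsum_of_injective Subtype.val_injective fun x => (G.w y x : ℝ≥0∞)

/-- The finite network obtained from `G` by collapsing `z` to one vertex `none` and killing the
walk when it leaves `S ∪ z`. -/
noncomputable def collapse (S : Finset ↥zᶜ) : KilledNetwork (Option S) where
  w
    | none, none => 0
    | some x, none => (G.weightTo z x).toReal
    | none, some x => (G.weightTo z x).toReal
    | some x, some y => G.w x y
  W
    | none => ∑ x : S, (G.weightTo z x).toReal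
    | some x => (G.vertexWeight x).toReal
  symm := by
    rintro (_ | x) (_ | y)
    · rfl
    · rfl
    · rfl
    · simp only [G.symm]
  nonneg := by
    rintro (_ | x) (_ | y) <;> positivity
  sum_le := by
    rintro (_ | x)
    · simp [Fintype.sum_option]
    · have hle := ENNReal.toReal_mono (G.vertexWeight_ne_top x) (G.weightTo_add_sum_le S x)
      rw [ENNReal.toReal_add (G.weightTo_ne_top x) (by simp), ENNReal.toReal_sum (by simp),
        ← Finset.sum_coe_sort S] at hle
      simpa [Fintype.sum_option, vertexWeight] using hle

theorem w_mul_truncLaplace_le {γ : ℝ≥0∞} {S : Finset ↥zᶜ} {N : ℕ} {a : ℝ≥0∞}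
    (h : G.vertexWeight y * G.truncLaplace γ S N y ≤ G.vertexWeight y * a) (x : V) :
    G.w x y * G.truncLaplace γ S N y ≤ G.w x y * a := by
  have hw := G.w_le_vertexWeight y x
  by_cases hy : G.vertexWeight y = 0
  · rw [hy, nonpos_iff_eq_zero, G.symm] at hw
    simp [hw]
  · exact mul_le_mul_right ((ENNReal.mul_le_mul_iff_right hy (G.vertexWeight_ne_top y)).1 h) _

theorem vertexWeight_mul_truncLaplace_succ (γ : ℝ≥0∞) (S : Finset ↥zᶜ) (N : ℕ) (x : V) :
    G.vertexWeight x * G.truncLaplace γ S (N + 1) x =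
      γ * (G.weightTo z x + ∑ y ∈ S, G.w x y * G.truncLaplace γ S N y) := by
  simp only [truncLaplace, ← G.vertexWeight_mul_stepMean_indicator_one, ← G.vertexWeight_mul_step,
    mul_left_comm _ γ, mul_add, Finset.mul_sum, mul_assoc]

theorem vertexWeight_mul_truncLaplace_le {S : Finset ↥zᶜ} {m : ℝ} (hm : 0 < m)
    {h : Option S → ℝ} (hh : (G.collapse S).IsDiscounted m none h) (N : ℕ) (x : S) :
    G.vertexWeight x * G.truncLaplace (ENNReal.ofReal m⁻¹) S N x ≤
      G.vertexWeight x * ENNReal.ofReal (h (some x)) := by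
  induction N generalizing x with
  | zero => simp [truncLaplace]
  | succ N ih =>
    have hmean := hh.mean (some x) (Option.some_ne_none x)
    rw [Fintype.sum_option, hh.target, mul_one] at hmean
    have hnonneg (y : S) : 0 ≤ (G.w x y : ℝ) * h (some y) :=
      mul_nonneg (NNReal.coe_nonneg _) (hh.nonneg _)
    calc G.vertexWeight x * G.truncLaplace (ENNReal.ofReal m⁻¹) S (N + 1) x
        ≤ ENNReal.ofReal m⁻¹ *
            (G.weightTo z x + ∑ y : S, G.w x y * ENNReal.ofReal (h (some y))) := by
          rw [vertexWeight_mul_truncLaplace_succ, ← Finset.sum_coe_sort S]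
          gcongr ENNReal.ofReal m⁻¹ * (_ + ∑ y, ?_)
          exact G.w_mul_truncLaplace_le (ih _) x
      _ = ENNReal.ofReal (m⁻¹ *
            ((G.weightTo z x).toReal + ∑ y : S, (G.w x y : ℝ) * h (some y))) := by
          rw [ENNReal.ofReal_mul (by positivity), ENNReal.ofReal_add ENNReal.toReal_nonneg
            (Finset.sum_nonneg fun y _ => hnonneg y), ENNReal.ofReal_toReal (G.weightTo_ne_top _),
            ENNReal.ofReal_sum_of_nonneg fun y _ => hnonneg y]
          simp only [ENNReal.ofReal_mul (NNReal.coe_nonneg _), ENNReal.ofReal_coe_nnreal]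
      _ = ENNReal.ofReal ((G.vertexWeight x).toReal * h (some x)) := by
          refine congrArg _ ((congrArg _ hmean).trans ?_)
          rw [mul_assoc, inv_mul_cancel_left₀ hm.ne']
          rfl
      _ = _ := by
          rw [ENNReal.ofReal_mul ENNReal.toReal_nonneg,
            ENNReal.ofReal_toReal (G.vertexWeight_ne_top _)]

end Collapse

section Distance

variable {o x y : V} {z : Set V} {n : ℕ}

theorem edist_le_succ (o : V) (h : G.w x y ≠ 0) :
    G.support.edist o y ≤ G.support.edist o x + 1 := by
  by_cases hxy : x = y
  · exact hxy ▸ le_self_add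
  · rw [← SimpleGraph.edist_eq_one_iff_adj.2 (show G.support.Adj x y from ⟨hxy, h⟩)]
    exact SimpleGraph.edist_triangle

theorem notMem_of_pos_le_distTo (hn : 0 < n) (hdist : (n : ℕ∞) ≤ G.distTo o z) : o ∉ z := by
  intro ho
  have := hdist.trans (iInf₂_le o ho)
  rw [SimpleGraph.edist_self, nonpos_iff_eq_zero, Nat.cast_eq_zero] at this
  exact hn.ne' this

/-- The distance from `o`, cut off at `n`. -/
noncomputable def cutDist (o : V) (n : ℕ) (x : V) : ℕ := (min (G.support.edist o x) n).toNat

theorem coe_cutDist (o : V) (n : ℕ) (x : V) :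
    (G.cutDist o n x : ℕ∞) = min (G.support.edist o x) n :=
  ENat.natCast_toNat ((min_le_right _ _).trans_lt (ENat.natCast_lt_top n)).ne

theorem cutDist_self (o : V) (n : ℕ) : G.cutDist o n o = 0 := by
  simp [cutDist]

theorem cutDist_le_succ (o : V) (n : ℕ) (h : G.w x y ≠ 0) :
    G.cutDist o n y ≤ G.cutDist o n x + 1 := by
  have : (G.cutDist o n y : ℕ∞) ≤ G.cutDist o n x + 1 := by
    rw [coe_cutDist, coe_cutDist, ← min_add_add_right]
    exact min_le_min (G.edist_le_succ o h) le_self_add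
  exact_mod_cast this

theorem cutDist_eq_of_weightTo_ne_zero (hdist : ((n + 1 : ℕ) : ℕ∞) ≤ G.distTo o z)
    (hx : G.weightTo z x ≠ 0) : G.cutDist o n x = n := by
  obtain ⟨y, hy, hw⟩ := G.exists_mem_w_ne_zero hx
  have hsucc : (n : ℕ∞) + 1 ≤ G.support.edist o x + 1 := by
    exact_mod_cast (hdist.trans (iInf₂_le y hy)).trans (G.edist_le_succ o hw)
  have hle : (n : ℕ∞) ≤ G.support.edist o x :=
    (ENat.add_le_add_iff_right ENat.one_ne_top).1 hsucc
  have := G.coe_cutDist o n x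
  rw [min_eq_right hle] at this
  exact_mod_cast this

/-- A potential on the collapsed network that is `1`-Lipschitz, grows from `1` at `o` to `n` at
`none`, and is constant around these two vertices. -/
noncomputable def collapseDist (o : V) (n : ℕ) {S : Finset ↥zᶜ} : Option S → ℝ
  | none => n
  | some x => (max 1 (G.cutDist o n x) : ℕ)

variable {S : Finset ↥zᶜ}

theorem collapseDist_eq_of_w_source_ne_zero {o : S} (hn : 1 ≤ n)
    (hdist : ((n + 1 : ℕ) : ℕ∞) ≤ G.distTo o z) {y : Option S}
    (hy : (G.collapse S).w (some o) y ≠ 0) : G.collapseDist o n y = 1 := by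
  rcases y with _ | y
  · have := G.cutDist_eq_of_weightTo_ne_zero hdist fun h0 => hy (congrArg ENNReal.toReal h0)
    rw [cutDist_self] at this
    lia
  · have := G.cutDist_le_succ o n (NNReal.coe_ne_zero.1 hy)
    rw [cutDist_self, zero_add] at this
    simp only [collapseDist, max_eq_left this, Nat.cast_one]

theorem collapseDist_eq_of_w_target_ne_zero (hn : 1 ≤ n)
    (hdist : ((n + 1 : ℕ) : ℕ∞) ≤ G.distTo o z) {y : Option S}
    (hy : (G.collapse S).w none y ≠ 0) : G.collapseDist o n y = n := by
  rcases y with _ | y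
  · rfl
  · have := G.cutDist_eq_of_weightTo_ne_zero hdist fun h0 => hy (congrArg ENNReal.toReal h0)
    simp only [collapseDist, this, max_eq_right hn]

theorem abs_collapseDist_sub_le (hn : 1 ≤ n) (hdist : ((n + 1 : ℕ) : ℕ∞) ≤ G.distTo o z)
    (x y : Option S) (hxy : (G.collapse S).w x y ≠ 0) :
    |G.collapseDist o n x - G.collapseDist o n y| ≤ 1 := by
  rcases x with _ | x
  · rw [G.collapseDist_eq_of_w_target_ne_zero hn hdist hxy]
    simp [collapseDist]
  rcases y with _ | y
  · rw [G.collapseDist_eq_of_w_target_ne_zero hn hdist ((G.collapse S).symm _ _ ▸ hxy)]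
    simp [collapseDist]
  · have hw : G.w x y ≠ 0 := NNReal.coe_ne_zero.1 hxy
    have hle := G.cutDist_le_succ o n hw
    have hge := G.cutDist_le_succ o n (G.symm x y ▸ hw)
    simp only [collapseDist]
    rw [abs_sub_le_iff, sub_le_iff_le_add, sub_le_iff_le_add]
    constructor <;> norm_cast <;> lia

end Distance

/-- The universal bound for the Laplace transform `E[exp (-l T)]`, where `R` bounds `w_z / w_o` and
`n` is the distance, is `exp (-rate R l n)`. -/
noncomputable def rate (R l : ℝ) (n : ℕ) : ℝ :=
  √((Real.log (R * Real.exp l / (Real.exp l - 1)) / 2) ^ 2 + 2 * l * ((n : ℝ) - 2) ^ 2) -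
    Real.log (R * Real.exp l / (Real.exp l - 1)) / 2 - 1

/- The two hypotheses bound the product of `-log A + 1` and `-log B + 1` from below and their
difference from above, so `-log A` is at least a root of a quadratic polynomial. -/
theorem le_exp_neg_rate {A B R l : ℝ} {n : ℕ} (hA : 0 < A) (hA1 : A ≤ 1) (hB1 : B ≤ 1) (hR : 0 < R)
    (hl : 0 < l) (hrev : A * (Real.exp l - 1) ≤ B * Real.exp l * R)
    (hprod : 2 * l * ((n : ℝ) - 2) ^ 2 ≤ (-Real.log A + 1) * (-Real.log B + 1)) :
    A ≤ Real.exp (-rate R l n) := by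
  have hexp : 0 < Real.exp l - 1 := sub_pos.2 (Real.one_lt_exp_iff.2 hl)
  have hB : 0 < B := by
    have := (mul_pos hA hexp).trans_le hrev
    rw [mul_assoc] at this
    exact pos_of_mul_pos_left this (by positivity)
  rw [← Real.log_le_iff_le_exp hA, rate]
  set L := Real.log (R * Real.exp l / (Real.exp l - 1)) with hL
  have hlogA : Real.log A ≤ 0 := Real.log_nonpos hA.le hA1
  have hlog : Real.log A ≤ Real.log B + L := by
    rw [hL, ← Real.log_mul hB.ne' (by positivity)]
    refine Real.log_le_log hA ?_
    rw [mul_div_assoc', le_div_iff₀ hexp]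
    linarith
  have hsqrt : √((L / 2) ^ 2 + 2 * l * ((n : ℝ) - 2) ^ 2) ≤ -Real.log A + 1 + L / 2 := by
    have hlogB : Real.log B ≤ 0 := Real.log_nonpos hB.le hB1
    refine Real.sqrt_le_iff.2 ⟨by linarith, ?_⟩
    have := mul_le_mul_of_nonneg_left (a := -Real.log A + 1)
      (show -Real.log B + 1 ≤ -Real.log A + 1 + L by linarith) (by linarith)
    linarith
  linarith

theorem collapse_le_exp_neg_rate {z : Set V} {n : ℕ} {S : Finset ↥zᶜ} {o : S} (hn : 2 ≤ n)
    (ho : 0 < G.vertexWeight o) (hdist : (n : ℕ∞) ≤ G.distTo o z) {R : ℝ} (hR : 0 < R)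
    (hz : ∑ x : S, (G.weightTo z x).toReal ≤ R * (G.vertexWeight o).toReal) {l : ℝ} (hl : 0 < l)
    {h : Option S → ℝ} (hh : (G.collapse S).IsDiscounted (Real.exp l) none h) :
    h (some o) ≤ Real.exp (-rate R l n) := by
  obtain ⟨n, rfl⟩ : ∃ k, n = k + 1 + 1 := ⟨n - 2, by lia⟩
  have hm : 1 < Real.exp l := Real.one_lt_exp_iff.2 hl
  have hWo : 0 < (G.vertexWeight o).toReal := ENNReal.toReal_pos ho.ne' (G.vertexWeight_ne_top _)
  obtain ⟨k, hk⟩ := (G.collapse S).exists_isDiscounted hm.le (some o)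
  rcases (hh.nonneg (some o)).eq_or_lt with h0 | hpos
  · exact h0 ▸ (Real.exp_pos _).le
  have hne : some o ≠ none := Option.some_ne_none o
  have hn1 : 1 ≤ n + 1 := n.succ_pos
  have hdo : G.collapseDist o (n + 1) (some o) = 1 := by simp [collapseDist, cutDist_self]
  have hrev : h (some o) * (Real.exp l - 1) ≤ k none * Real.exp l * R := by
    refine le_of_mul_le_mul_right ((hh.mul_weight_source_le hk hne).trans ?_) hWo
    rw [mul_assoc _ R]
    exact mul_le_mul_of_nonneg_left hz (mul_nonneg (hk.nonneg _) (Real.exp_pos l).le)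
  have hprod := hh.two_mul_log_mul_sq_le hk hm hne hpos hWo (d := G.collapseDist o (n + 1))
    (G.abs_collapseDist_sub_le hn1 hdist)
    (fun y hy => (G.collapseDist_eq_of_w_source_ne_zero hn1 hdist hy).trans hdo.symm)
    (fun y hy => G.collapseDist_eq_of_w_target_ne_zero hn1 hdist hy)
    (by rw [hdo]; simp [collapseDist])
  refine le_exp_neg_rate hpos (hh.le_one _) (hk.le_one _) hR hl hrev ?_
  rw [Real.log_exp, hdo] at hprod
  refine le_of_eq_of_le ?_ hprod
  simp only [collapseDist]
  push_cast
  ring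

theorem laplace_le {z : Set V} {o : V} {n : ℕ} (hn : 2 ≤ n) (ho : 0 < G.vertexWeight o)
    (hdist : (n : ℕ∞) ≤ G.distTo o z) {R : ℝ} (hR : 0 < R)
    (hz : G.setWeight z / G.vertexWeight o ≤ ENNReal.ofReal R) {l : ℝ} (hl : 0 < l) (N : ℕ) :
    G.laplace z (ENNReal.ofReal (Real.exp (-l))) N o ≤
      ENNReal.ofReal (Real.exp (-rate R l n)) := by
  classical
  have hoz : o ∉ z := G.notMem_of_pos_le_distTo (by lia) hdist
  have htop := G.vertexWeight_ne_top o
  refine (G.laplace_le_iSup_truncLaplace _ N o).trans (iSup_le fun F => ?_)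
  obtain ⟨S, hFS, hoS⟩ : ∃ S, F ⊆ S ∧ ⟨o, hoz⟩ ∈ S :=
    ⟨insert ⟨o, hoz⟩ F, Finset.subset_insert _ _, Finset.mem_insert_self _ _⟩
  have hweight : ∑ x : S, (G.weightTo z x).toReal ≤ R * (G.vertexWeight o).toReal := by
    rw [ENNReal.div_le_iff ho.ne' htop] at hz
    have := ENNReal.toReal_mono (ENNReal.mul_ne_top ENNReal.ofReal_ne_top htop)
      ((G.sum_weightTo_le S).trans hz)
    rwa [ENNReal.toReal_mul, ENNReal.toReal_ofReal hR.le,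
      ENNReal.toReal_sum fun x _ => G.weightTo_ne_top _, ← Finset.sum_coe_sort S] at this
  obtain ⟨h, hh⟩ := (G.collapse S).exists_isDiscounted (Real.one_lt_exp_iff.2 hl).le none
  have hmono := G.truncLaplace_mono (ENNReal.ofReal (Real.exp (-l))) N o hFS
  have htrunc := G.vertexWeight_mul_truncLaplace_le (Real.exp_pos l) hh N
    ⟨⟨o, hoz⟩, hoS⟩
  rw [ENNReal.mul_le_mul_iff_right ho.ne' htop, ← Real.exp_neg] at htrunc
  exact (hmono.trans htrunc).trans (ENNReal.ofReal_le_ofReal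
    (G.collapse_le_exp_neg_rate (o := ⟨⟨o, hoz⟩, hoS⟩) hn ho hdist hR hweight hl hh))

section UpperBound

theorem tendsto_rate_div_log {c ℓ : ℝ} (p : ℝ) (hc : 0 < c) (hℓ : 0 < ℓ) :
    Tendsto (fun n : ℕ => rate (c * (n : ℝ) ^ p) (killRate ℓ n) n / Real.log n) atTop
      (𝓝 (laplaceExponent ((p + 2) / 2) ℓ)) := by
  have hweight := (tendsto_log_weight_div_log p hc hℓ).div_const 2
  have hdist : Tendsto (fun n : ℕ => 1 - 2 / (n : ℝ)) atTop (𝓝 (1 - 0)) :=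
    tendsto_const_nhds.sub (tendsto_const_nhds.div_atTop tendsto_natCast_atTop_atTop)
  have hsqrt := ((hweight.pow 2).add ((hdist.pow 2).const_mul (2 * ℓ))).sqrt
  have hlim := (hsqrt.sub hweight).sub (tendsto_const_div_log 1)
  simp only [sub_zero, one_pow, mul_one] at hlim
  refine hlim.congr' ?_
  filter_upwards [eventually_natCast_pos_and_log_pos] with n ⟨hn, hlog⟩
  rw [rate]
  set L := Real.log (c * (n : ℝ) ^ p * Real.exp (killRate ℓ n) / (Real.exp (killRate ℓ n) - 1))
  have hfactor : (L / 2) ^ 2 + 2 * killRate ℓ n * ((n : ℝ) - 2) ^ 2 =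
      Real.log n ^ 2 * ((L / Real.log n / 2) ^ 2 + 2 * ℓ * (1 - 2 / (n : ℝ)) ^ 2) := by
    rw [killRate]
    field_simp
  rw [hfactor, Real.sqrt_mul (by positivity), Real.sqrt_sq hlog.le]
  field_simp

theorem IsAdmissible.notMem {G : WeightedGraph V} {c p : ℝ} {n : ℕ} {o : V} {z : Set V}
    (h : G.IsAdmissible c p n o z) (hn : 0 < n) : o ∉ z :=
  G.notMem_of_pos_le_distTo hn h.le_dist

theorem eventually_laplace_le {c ℓ ε : ℝ} (p : ℝ) (hc : 0 < c) (hℓ : 0 < ℓ) (hε : 0 < ε) :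
    ∀ᶠ n : ℕ in atTop, ∀ (V : Type u) (G : WeightedGraph V) (o : V) (z : Set V),
      G.IsAdmissible c p n o z → ∀ N,
        G.laplace z (ENNReal.ofReal (Real.exp (-killRate ℓ n))) N o ≤
          ENNReal.ofReal ((n : ℝ) ^ (-laplaceExponent ((p + 2) / 2) ℓ + ε)) := by
  filter_upwards [(tendsto_rate_div_log p hc hℓ).eventually_const_lt (sub_lt_self _ hε),
    eventually_natCast_pos_and_log_pos, eventually_ge_atTop 2, eventually_killRate_pos hℓ]
    with n hrate ⟨hn, hlog⟩ hn2 hk V G o z hadm N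
  refine (G.laplace_le hn2 hadm.pos hadm.le_dist (by positivity) hadm.weight_lt.le hk N).trans
    (ENNReal.ofReal_le_ofReal ?_)
  rw [Real.rpow_def_of_pos hn (_ + ε)]
  rw [lt_div_iff₀ hlog] at hrate
  exact Real.exp_le_exp.2 (by linarith)

theorem ofReal_exp_mul_laplace (z : Set V) (a l : ℝ) (N : ℕ) (o : V) :
    ENNReal.ofReal (Real.exp a) * G.laplace z (ENNReal.ofReal (Real.exp (-l))) N o =
      ∑ k ∈ Finset.range N, ENNReal.ofReal (Real.exp (a - l * (k + 1))) * G.hitAt z k o := by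
  rw [laplace, Finset.mul_sum]
  refine Finset.sum_congr rfl fun k _ => ?_
  rw [← mul_assoc, ← ENNReal.ofReal_pow (Real.exp_pos _).le, ← Real.exp_nat_mul,
    ← ENNReal.ofReal_mul (Real.exp_pos _).le, ← Real.exp_add]
  congr 3
  push_cast
  ring

theorem add_one_lt_of_mem_range_ceil_sub_one {t : ℝ} {k : ℕ}
    (hk : k ∈ Finset.range (⌈t⌉₊ - 1)) : (k : ℝ) + 1 < t := by
  rw [Finset.mem_range, Nat.lt_sub_iff_add_lt, Nat.lt_ceil] at hk
  exact_mod_cast hk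

theorem probHitBefore_le_exp_mul_laplace [MeasurableSpace V] [DiscreteMeasurableSpace V] {o : V}
    {z : Set V} (ho : o ∉ z) (t : ℝ) {l : ℝ} (hl : 0 ≤ l) :
    G.probHitBefore o z t ≤ ENNReal.ofReal (Real.exp (l * t)) *
      G.laplace z (ENNReal.ofReal (Real.exp (-l))) (⌈t⌉₊ - 1) o := by
  rw [G.probHitBefore_eq ho, ofReal_exp_mul_laplace]
  refine Finset.sum_le_sum fun k hk => le_mul_of_one_le_left' ?_
  rw [ENNReal.one_le_ofReal, Real.one_le_exp_iff, sub_nonneg]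
  exact mul_le_mul_of_nonneg_left (add_one_lt_of_mem_range_ceil_sub_one hk).le hl

variable {c p α : ℝ}

theorem eventually_probHitBefore_le {ε : ℝ} (hc : 0 < c) (hp : -2 < p) (hα : 0 < α)
    (hα' : α < 2 / (p + 2)) (hε : 0 < ε) :
    ∀ᶠ n : ℕ in atTop, ∀ (V : Type u) (_ : MeasurableSpace V) (_ : DiscreteMeasurableSpace V)
      (G : WeightedGraph V) (o : V) (z : Set V), G.IsAdmissible c p n o z →
        G.probHitBefore o z (α * (n : ℝ) ^ 2 / Real.log n) ≤
          ENNReal.ofReal ((n : ℝ) ^ (-(α * (p + 2) - 2) ^ 2 / (8 * α) + ε)) := by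
  rw [lt_div_iff₀ (by linarith)] at hα'
  set ℓ := dualRate ((p + 2) / 2) α with hℓ
  have hℓ0 : 0 < ℓ := dualRate_pos (by linarith) hα (by linarith)
  filter_upwards [eventually_laplace_le.{u} p hc hℓ0 hε, eventually_natCast_pos_and_log_pos,
    eventually_killRate_pos hℓ0] with n hlaplace ⟨hn, hlog⟩ hk V _ _ G o z hadm
  have hoz : o ∉ z := hadm.notMem (by exact_mod_cast hn)
  refine (G.probHitBefore_le_exp_mul_laplace hoz _ hk.le).trans ?_
  refine (mul_le_mul_right (hlaplace V G o z hadm _) _).trans_eq ?_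
  rw [killRate_mul ℓ α hn hlog, ← Real.rpow_def_of_pos hn, ← ENNReal.ofReal_mul (by positivity),
    ← Real.rpow_add hn, ← dualRate_mul_sub_laplaceExponent p hα, ← hℓ]
  ring_nf

theorem eventually_supProbHitSet_le {ε : ℝ} (hc : 0 < c) (hp : -2 < p) (hα : 0 < α)
    (hα' : α < 2 / (p + 2)) (hε : 0 < ε) :
    ∀ᶠ n : ℕ in atTop, supProbHitSet.{u} c p n (α * (n : ℝ) ^ 2 / Real.log n) ≤
      ENNReal.ofReal ((n : ℝ) ^ (-(α * (p + 2) - 2) ^ 2 / (8 * α) + ε)) := by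
  filter_upwards [eventually_probHitBefore_le.{u} hc hp hα hα' hε] with n h
  simp only [supProbHitSet, iSup_le_iff]
  exact h

theorem eventually_le_infExpectedHitSet {a : ℝ} (hc : 0 < c) (hp : -2 < p) (ha : 0 < a)
    (ha' : a < 2 / (p + 2)) :
    ∀ᶠ n : ℕ in atTop, ENNReal.ofReal (a * ((n : ℝ) ^ 2 / Real.log n)) ≤
      infExpectedHitSet.{u} c p n := by
  obtain ⟨α, haα, hα'⟩ := exists_between ha'
  have hα : 0 < α := ha.trans haα
  set E := (α * (p + 2) - 2) ^ 2 / (8 * α) with hE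
  have hE0 : 0 < E := by
    rw [lt_div_iff₀ (by linarith)] at hα'
    have := sq_pos_of_neg (sub_neg.2 hα')
    positivity
  filter_upwards [eventually_probHitBefore_le.{u} hc hp hα hα' (half_pos hE0),
    (tendsto_natCast_rpow_neg (half_pos hE0)).eventually_lt_const
      (sub_pos.2 ((div_lt_one hα).2 haα)), eventually_natCast_pos_and_log_pos]
    with n hprob hsmall ⟨hn, hlog⟩
  simp only [infExpectedHitSet, le_iInf_iff]
  intro V _ _ G o z hadm
  have hle : G.probHitBefore o z (α * (n : ℝ) ^ 2 / Real.log n) ≤ ENNReal.ofReal (1 - a / α) := by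
    refine (hprob V _ _ G o z hadm).trans (ENNReal.ofReal_le_ofReal ?_)
    rw [neg_div, ← hE, show -E + E / 2 = -(E / 2) by ring]
    exact hsmall.le
  calc ENNReal.ofReal (a * ((n : ℝ) ^ 2 / Real.log n))
      = ENNReal.ofReal (α * (n : ℝ) ^ 2 / Real.log n) * (1 - ENNReal.ofReal (1 - a / α)) := by
        rw [← ENNReal.ofReal_one, ← ENNReal.ofReal_sub _ (sub_nonneg.2 ((div_le_one hα).2 haα.le)),
          ← ENNReal.ofReal_mul (by positivity), sub_sub_cancel]
        congr 1
        field_simp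
    _ ≤ ENNReal.ofReal (α * (n : ℝ) ^ 2 / Real.log n) *
          (1 - G.probHitBefore o z (α * (n : ℝ) ^ 2 / Real.log n)) := by gcongr
    _ ≤ G.expectedHit o z := G.ofReal_mul_one_sub_probHitBefore_le_expectedHit o z _

end UpperBound

section Comparison

theorem stepMean_mono {f g : V → ℝ≥0∞} (h : f ≤ g) : G.stepMean f ≤ G.stepMean g :=
  fun _ => ENNReal.tsum_le_tsum fun y => by gcongr; exact h y

theorem stepMean_add (f g : V → ℝ≥0∞) (x : V) :
    G.stepMean (f + g) x = G.stepMean f x + G.stepMean g x := by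
  simp only [stepMean, Pi.add_apply, mul_add, ENNReal.tsum_add]

theorem stepMean_const (a : ℝ≥0∞) (x : V) : G.stepMean (fun _ => a) x = a := by
  simp [stepMean, ENNReal.tsum_mul_right, PMF.tsum_coe]

theorem vertexWeight_mul_stepMean (f : V → ℝ≥0∞) (x : V) :
    G.vertexWeight x * G.stepMean f x = ∑' y, G.w x y * f y := by
  simp only [stepMean, ← ENNReal.tsum_mul_left, ← mul_assoc, vertexWeight_mul_step]

theorem one_add_stepMean_le {f : V → ℝ≥0∞} {x : V} {a : ℝ≥0∞} (hx : G.vertexWeight x ≠ 0)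
    (h : G.vertexWeight x + ∑' y, G.w x y * f y ≤ G.vertexWeight x * a) :
    1 + G.stepMean f x ≤ a := by
  rwa [← ENNReal.mul_le_mul_iff_right hx (G.vertexWeight_ne_top x), mul_add, mul_one,
    vertexWeight_mul_stepMean]

theorem le_mul_stepMean {f : V → ℝ≥0∞} {x : V} {a γ : ℝ≥0∞} (hx : G.vertexWeight x ≠ 0)
    (h : G.vertexWeight x * a ≤ γ * ∑' y, G.w x y * f y) : a ≤ γ * G.stepMean f x := by
  rwa [← ENNReal.mul_le_mul_iff_right hx (G.vertexWeight_ne_top x), mul_left_comm,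
    vertexWeight_mul_stepMean]

variable {o : V} {z : Set V}

theorem killed_le_stepMean {f g : V → ℝ≥0∞} (h : ∀ x ∉ z, f x ≤ g x) :
    G.killed z f ≤ G.stepMean g :=
  G.stepMean_mono (Set.indicator_le h)

theorem tsum_killed_le_of_supersolution {v : V → ℝ≥0∞} (hv : ∀ x ∉ z, 1 + G.stepMean v x ≤ v x)
    (ho : o ∉ z) : ∑' k, (G.killed z)^[k] 1 o ≤ v o := by
  refine ENNReal.tsum_le_of_sum_range_le fun N => ?_
  induction N generalizing o with
  | zero => simp
  | succ N ih =>
    have hshift : ∑ k ∈ Finset.range N, (G.killed z)^[k + 1] 1 o =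
        G.killed z (fun y => ∑ k ∈ Finset.range N, 1 * (G.killed z)^[k] 1 y) o := by
      rw [killed_sum]
      simp only [one_mul, Function.iterate_succ_apply']
    rw [Finset.sum_range_succ', hshift, add_comm]
    refine le_trans (add_le_add le_rfl ?_) (hv o ho)
    exact G.killed_le_stepMean (fun x hx => by simpa using ih hx) o

section Subsolution

variable {γ : ℝ≥0∞} {φ : V → ℝ≥0∞}

theorem le_laplace_add_pow_of_subsolution (hφ1 : ∀ x, φ x ≤ 1)
    (hφ : ∀ x ∉ z, φ x ≤ γ * G.stepMean φ x) (N : ℕ) (ho : o ∉ z) :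
    φ o ≤ G.laplace z γ N o + γ ^ N := by
  induction N generalizing o with
  | zero => simpa using le_add_left (hφ1 o)
  | succ N ih =>
    have hstep : G.stepMean φ o ≤ G.stepMean (z.indicator 1) o +
        G.killed z (G.laplace z γ N) o + γ ^ N := by
      rw [killed, ← G.stepMean_const (γ ^ N) o, ← stepMean_add, ← stepMean_add]
      refine G.stepMean_mono (fun y => ?_) o
      by_cases hy : y ∈ z
      · simpa [hy] using (hφ1 y).trans le_self_add
      · simpa [hy] using ih hy
    calc φ o ≤ γ * G.stepMean φ o := hφ o ho
      _ ≤ γ * (G.stepMean (z.indicator 1) o + G.killed z (G.laplace z γ N) o + γ ^ N) := by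
        gcongr
      _ = G.laplace z γ (N + 1) o + γ ^ (N + 1) := by
        rw [laplace_succ, pow_succ', mul_add γ]

theorem le_iSup_laplace_of_subsolution (hφ1 : ∀ x, φ x ≤ 1)
    (hφ : ∀ x ∉ z, φ x ≤ γ * G.stepMean φ x) (hγ : γ < 1) (ho : o ∉ z) :
    φ o ≤ ⨆ N, G.laplace z γ N o := by
  have hlim : Tendsto (fun N : ℕ => (⨆ N, G.laplace z γ N o) + γ ^ N) atTop
      (𝓝 ((⨆ N, G.laplace z γ N o) + 0)) :=
    tendsto_const_nhds.add (ENNReal.tendsto_pow_atTop_nhds_zero_of_lt_one hγ)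
  rw [add_zero] at hlim
  refine ge_of_tendsto' hlim fun N =>
    (G.le_laplace_add_pow_of_subsolution hφ1 hφ N ho).trans ?_
  gcongr
  exact le_iSup (fun N => G.laplace z γ N o) N

end Subsolution

theorem le_distTo {n : ℕ} (f : V → ℕ) (ho : f o = 0) (hz : ∀ x ∈ z, f x = n)
    (hf : ∀ x y, G.w x y ≠ 0 → f y ≤ f x + 1) : (n : ℕ∞) ≤ G.distTo o z := by
  have hwalk {x y : V} (p : G.support.Walk x y) : f y ≤ f x + p.length := by
    induction p with
    | nil => simp
    | cons h p ih =>
      have := hf _ _ h.2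
      rw [SimpleGraph.Walk.length_cons]
      lia
  refine le_iInf₂ fun x hx => ?_
  rw [← hz x hx, SimpleGraph.edist, le_iInf_iff]
  intro p
  simpa [ho] using hwalk p

/- The three terms bound the cases `τ ≤ s`, `s ≤ τ < t` and `t ≤ τ`. -/
theorem ofReal_exp_neg_mul_le {l ϑ : ℝ} (hl : 0 ≤ l) (hϑ : 0 ≤ ϑ) (s t τ : ℝ) :
    ENNReal.ofReal (Real.exp (0 - l * τ)) ≤ ENNReal.ofReal (Real.exp (ϑ * s - (l + ϑ) * τ)) +
      (if τ < t then ENNReal.ofReal (Real.exp (-(l * s))) else 0) +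
      ENNReal.ofReal (Real.exp (-(ϑ * t) - (l - ϑ) * τ)) := by
  have hle {a b : ℝ} (h : a ≤ b) : ENNReal.ofReal (Real.exp a) ≤ ENNReal.ofReal (Real.exp b) :=
    ENNReal.ofReal_le_ofReal (Real.exp_le_exp.2 h)
  rcases le_total τ s with hs | hs
  · refine le_trans (hle ?_) (le_self_add.trans le_self_add)
    linarith [mul_le_mul_of_nonneg_left hs hϑ]
  by_cases ht : τ < t
  · rw [if_pos ht]
    refine le_trans (hle ?_) (le_add_self.trans le_self_add)
    linarith [mul_le_mul_of_nonneg_left hs hl]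
  · refine le_trans (hle ?_) le_add_self
    linarith [mul_le_mul_of_nonneg_left (not_lt.1 ht) hϑ]

variable [MeasurableSpace V] [DiscreteMeasurableSpace V]

theorem sum_hitAt_le_probHitBefore (ho : o ∉ z) (t : ℝ) (N : ℕ) :
    ∑ k ∈ Finset.range N with ((k : ℕ) : ℝ) + 1 < t, G.hitAt z k o ≤ G.probHitBefore o z t := by
  rw [G.probHitBefore_eq ho]
  refine Finset.sum_le_sum_of_subset fun k hk => ?_
  rw [Finset.mem_range, Nat.lt_sub_iff_add_lt, Nat.lt_ceil]
  exact_mod_cast (Finset.mem_filter.1 hk).2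

theorem laplace_le_add_probHitBefore_add (ho : o ∉ z) {l ϑ : ℝ} (hl : 0 ≤ l) (hϑ : 0 ≤ ϑ)
    (s t : ℝ) (N : ℕ) :
    G.laplace z (ENNReal.ofReal (Real.exp (-l))) N o ≤
      ENNReal.ofReal (Real.exp (ϑ * s)) *
          G.laplace z (ENNReal.ofReal (Real.exp (-(l + ϑ)))) N o +
        ENNReal.ofReal (Real.exp (-(l * s))) * G.probHitBefore o z t +
        ENNReal.ofReal (Real.exp (-(ϑ * t))) *
          G.laplace z (ENNReal.ofReal (Real.exp (-(l - ϑ)))) N o := by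
  have hlaplace := G.ofReal_exp_mul_laplace z 0 l N o
  rw [Real.exp_zero, ENNReal.ofReal_one, one_mul] at hlaplace
  refine le_trans ?_ (add_le_add_left (add_le_add_right
    (mul_le_mul_right (G.sum_hitAt_le_probHitBefore ho t N) _) _) _)
  rw [hlaplace, ofReal_exp_mul_laplace, ofReal_exp_mul_laplace, Finset.sum_filter,
    Finset.mul_sum, ← Finset.sum_add_distrib, ← Finset.sum_add_distrib]
  refine Finset.sum_le_sum fun k _ => ?_
  refine (mul_le_mul_left (ofReal_exp_neg_mul_le hl hϑ s t (k + 1)) _).trans_eq ?_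
  simp only [add_mul, ite_mul, zero_mul, mul_ite, mul_zero]

end Comparison

section Path

/-- The weights of a path on `ℕ`: `e (i + 1)` is the weight of the edge between `i` and `i + 1`, and
`e 0` that of a loop at `0` (where `i = j - 1` holds because subtraction is truncated). -/
def pathWeight (e : ℕ → ℝ≥0) (i j : ℕ) : ℝ≥0 := if i = j - 1 ∨ j = i - 1 then e (max i j) else 0

theorem pathWeight_comm (e : ℕ → ℝ≥0) (i j : ℕ) : pathWeight e i j = pathWeight e j i := by
  simp only [pathWeight, max_comm, or_comm]

theorem tsum_pathWeight_mul (e : ℕ → ℝ≥0) (f : ULift.{u} ℕ → ℝ≥0∞) (i : ℕ) :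
    ∑' y : ULift.{u} ℕ, (pathWeight e i y.down : ℝ≥0∞) * f y =
      e i * f ⟨i - 1⟩ + e (i + 1) * f ⟨i + 1⟩ := by
  rw [tsum_eq_sum (s := {⟨i - 1⟩, ⟨i + 1⟩}), Finset.sum_pair (by simp)]
  · simp [pathWeight]
  · rintro ⟨j⟩ hj
    simp only [Finset.mem_insert, Finset.mem_singleton, ULift.up.injEq, not_or] at hj
    rw [pathWeight, if_neg (by lia), ENNReal.coe_zero, zero_mul]

theorem tsum_pathWeight (e : ℕ → ℝ≥0) (i : ℕ) :
    ∑' y : ULift.{u} ℕ, (pathWeight e i y.down : ℝ≥0∞) = (e i + e (i + 1) : ℝ≥0) := by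
  simpa using tsum_pathWeight_mul.{u} e 1 i

/-- The weighted path on `ℕ` with a loop at `0` and the weights `pathWeight e`. -/
def path (e : ℕ → ℝ≥0) : WeightedGraph (ULift.{u} ℕ) where
  w x y := pathWeight e x.down y.down
  symm x y := pathWeight_comm e x.down y.down
  tsum_ne_top x := tsum_pathWeight e x.down ▸ ENNReal.coe_ne_top

variable {e : ℕ → ℝ≥0} {n : ℕ}

theorem path_vertexWeight (e : ℕ → ℝ≥0) (i : ℕ) :
    (path.{u} e).vertexWeight ⟨i⟩ = (e i + e (i + 1) : ℝ≥0) :=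
  tsum_pathWeight e i

theorem path_vertexWeight_ne_zero {i : ℕ} (hi : e (i + 1) ≠ 0) :
    (path.{u} e).vertexWeight ⟨i⟩ ≠ 0 := by
  simp [path_vertexWeight, hi]

theorem path_tsum_w_mul (e : ℕ → ℝ≥0) (f : ULift.{u} ℕ → ℝ≥0∞) (i : ℕ) :
    ∑' y, ((path.{u} e).w ⟨i⟩ y : ℝ≥0∞) * f y = e i * f ⟨i - 1⟩ + e (i + 1) * f ⟨i + 1⟩ :=
  tsum_pathWeight_mul e f i

theorem path_le_distTo (e : ℕ → ℝ≥0) (n : ℕ) : (n : ℕ∞) ≤ (path.{u} e).distTo ⟨0⟩ {⟨n⟩} := by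
  refine le_distTo _ ULift.down rfl (by simp) fun x y hxy => ?_
  have : x.down = y.down - 1 ∨ y.down = x.down - 1 := by
    by_contra h
    exact hxy (if_neg h)
  lia

theorem zero_notMem_path_target (hn : 0 < n) :
    (⟨0⟩ : ULift.{u} ℕ) ∉ ({⟨n⟩} : Set (ULift.{u} ℕ)) := by
  rw [Set.mem_singleton_iff, ULift.up.injEq]
  exact hn.ne

/- Crossing the edge from `i` to `i + 1` takes in mean the total weight of `0, …, i` divided by the
weight of the edge. -/
theorem path_expectedHit_le (hn : 0 < n) (he : ∀ i < n, e (i + 1) ≠ 0) :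
    (path.{u} e).expectedHit ⟨0⟩ {⟨n⟩} ≤
      (∑ i ∈ Finset.range n, (∑ j ∈ Finset.range (i + 1), (e j + e (j + 1))) / e (i + 1) :
        ℝ≥0) := by
  set S : ℕ → ℝ≥0 := fun i => ∑ j ∈ Finset.range i, (e j + e (j + 1)) with hS
  set v : ℕ → ℝ≥0 := fun x => ∑ i ∈ Finset.Ico x n, S (i + 1) / e (i + 1) with hv
  have hcross : ∀ i < n, e (i + 1) * v i = S (i + 1) + e (i + 1) * v (i + 1) := fun i hi => by
    simp only [hv]
    rw [Finset.sum_eq_sum_Ico_succ_bot hi, mul_add, mul_div_cancel₀ _ (he i hi)]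
  have hback : ∀ i < n, e i * v (i - 1) = S i + e i * v i := by
    rintro (_ | i) hi
    · simp [hS]
    · exact hcross i (by lia)
  have hsol : ∀ i < n, e i + e (i + 1) + (e i * v (i - 1) + e (i + 1) * v (i + 1)) =
      (e i + e (i + 1)) * v i := fun i hi => by
    rw [hback i hi, add_mul, hcross i hi]
    simp only [hS, Finset.sum_range_succ]
    ring
  let F : ULift.{u} ℕ → ℝ≥0∞ := fun x => if x.down ≤ n then v x.down else ⊤
  have hF : ∀ i ≤ n, F ⟨i⟩ = v i := fun i hi => if_pos hi
  have h0 := zero_notMem_path_target.{u} hn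
  refine (expectedHit_le_tsum_killed _ h0).trans
    ((tsum_killed_le_of_supersolution _ (v := F) ?_ h0).trans_eq ?_)
  · rintro ⟨i⟩ hi
    rcases lt_or_ge i n with hlt | hge
    · refine one_add_stepMean_le _ (path_vertexWeight_ne_zero (he i hlt)) ?_
      rw [path_vertexWeight, path_tsum_w_mul, hF i hlt.le, hF (i - 1) (by lia), hF (i + 1) hlt]
      exact_mod_cast (hsol i hlt).le
    · have hin : i ≠ n := by simpa using hi
      have hFi : F ⟨i⟩ = ⊤ := if_neg (by dsimp only; lia)
      exact hFi ▸ le_top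
  · simp only [hF 0 hn.le, hv, hS, ← Finset.range_eq_Ico]

theorem path_le_iSup_laplace (hn : 0 < n) (he : ∀ i < n, e (i + 1) ≠ 0) {l : ℝ} (hl : 0 < l)
    {φ : ℕ → ℝ} {M : ℝ} (hM : 0 < M) (hφ0 : ∀ i ≤ n, 0 ≤ φ i) (hφM : ∀ i ≤ n, φ i ≤ M)
    (hφ : ∀ i < n, Real.exp l * ((e i + e (i + 1)) * φ i) ≤
      e i * φ (i - 1) + e (i + 1) * φ (i + 1)) :
    ENNReal.ofReal (φ 0 / M) ≤
      ⨆ N, (path.{u} e).laplace {⟨n⟩} (ENNReal.ofReal (Real.exp (-l))) N ⟨0⟩ := by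
  let F : ULift.{u} ℕ → ℝ≥0∞ := fun x => if x.down ≤ n then ENNReal.ofReal (φ x.down / M) else 0
  have hF : ∀ i ≤ n, F ⟨i⟩ = ENNReal.ofReal (φ i / M) := fun i hi => if_pos hi
  rw [← hF 0 hn.le]
  have hγ : ENNReal.ofReal (Real.exp (-l)) < 1 := by
    rw [ENNReal.ofReal_lt_one, Real.exp_lt_one_iff]
    exact neg_lt_zero.2 hl
  refine le_iSup_laplace_of_subsolution _ (φ := F) (fun x => ?_) ?_ hγ
    (zero_notMem_path_target hn)
  · dsimp only [F]
    split_ifs with hx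
    · exact ENNReal.ofReal_le_one.2 ((div_le_one hM).2 (hφM _ hx))
    · exact zero_le_one
  rintro ⟨i⟩ hi
  rcases lt_or_ge i n with hlt | hge
  · refine le_mul_stepMean _ (path_vertexWeight_ne_zero (he i hlt)) ?_
    have hprev : 0 ≤ φ (i - 1) / M := div_nonneg (hφ0 _ (by lia)) hM.le
    have hnext : 0 ≤ φ (i + 1) / M := div_nonneg (hφ0 _ hlt) hM.le
    rw [path_vertexWeight, path_tsum_w_mul, hF i hlt.le, hF (i - 1) (by lia), hF (i + 1) hlt]
    simp only [← ENNReal.ofReal_coe_nnreal]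
    rw [← ENNReal.ofReal_mul (by positivity), ← ENNReal.ofReal_mul (by positivity),
      ← ENNReal.ofReal_mul (by positivity), ← ENNReal.ofReal_add (by positivity) (by positivity),
      ← ENNReal.ofReal_mul (by positivity)]
    refine ENNReal.ofReal_le_ofReal ?_
    rw [Real.exp_neg, le_inv_mul_iff₀ (Real.exp_pos l)]
    have := div_le_div_of_nonneg_right (hφ i hlt) hM.le
    push_cast
    calc _ = Real.exp l * ((e i + e (i + 1)) * φ i) / M := by ring
      _ ≤ _ := this
      _ = _ := by ring
  · have hin : i ≠ n := by simpa using hi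
    have hFi : F ⟨i⟩ = 0 := if_neg (by dsimp only; lia)
    exact hFi ▸ zero_le

end Path

section FastPath

/-- The edge weights of the fast path of length `n`: a loop of weight `K` at `0`, then the weights
`1, ρ, ρ ^ 2, …, ρ ^ (n - 2)`, and `η` for the edge that leads to the target. -/
def fastEdge (ρ η K : ℝ≥0) (n : ℕ) : ℕ → ℝ≥0
  | 0 => K
  | i + 1 => if i + 1 < n then ρ ^ i else if i + 1 = n then η else 0

variable {ρ η K : ℝ≥0} {n : ℕ}

theorem fastEdge_succ_of_lt {i : ℕ} (h : i + 1 < n) : fastEdge ρ η K n (i + 1) = ρ ^ i := if_pos h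

theorem fastEdge_self (hn : 0 < n) : fastEdge ρ η K n n = η := by
  obtain ⟨k, rfl⟩ := Nat.exists_eq_add_one.2 hn
  rw [fastEdge, if_neg (lt_irrefl _), if_pos rfl]

theorem fastEdge_succ_self : fastEdge ρ η K n (n + 1) = 0 := by
  rw [fastEdge, if_neg (by lia), if_neg (by lia)]

theorem fastEdge_succ_ne_zero (hρ : ρ ≠ 0) (hη : η ≠ 0) {i : ℕ} (hi : i < n) :
    fastEdge ρ η K n (i + 1) ≠ 0 := by
  rcases Nat.lt_or_eq_of_le (Nat.succ_le_of_lt hi) with h | rfl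
  · exact fastEdge_succ_of_lt h ▸ pow_ne_zero i hρ
  · rwa [fastEdge_self i.succ_pos]

theorem sum_fastEdge_add_succ {i : ℕ} (hi : i < n) :
    ∑ j ∈ Finset.range (i + 1), (fastEdge ρ η K n j + fastEdge ρ η K n (j + 1)) =
      K + 2 * ∑ j ∈ Finset.range i, ρ ^ j + fastEdge ρ η K n (i + 1) := by
  induction i with
  | zero => simp [fastEdge]
  | succ i ih =>
    rw [Finset.sum_range_succ, ih (by lia), Finset.sum_range_succ _ i, fastEdge_succ_of_lt hi]
    ring

theorem geom_sum_le_pow_div_sub_one {r : ℝ} (hr : 1 < r) (k : ℕ) :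
    ∑ j ∈ Finset.range k, r ^ j ≤ r ^ k / (r - 1) := by
  rw [geom_sum_eq hr.ne']
  exact div_le_div_of_nonneg_right (sub_le_self _ zero_le_one) (sub_nonneg.2 hr.le)

theorem geom_sum_inv_le {r : ℝ} (hr : 1 < r) (k : ℕ) :
    ∑ j ∈ Finset.range k, r⁻¹ ^ j ≤ r / (r - 1) := by
  have : 0 < r := one_pos.trans hr
  refine (Summable.sum_le_tsum _ (fun j _ => by positivity) (summable_geometric_of_lt_one
    (by positivity) (inv_lt_one_of_one_lt₀ hr))).trans_eq ?_
  rw [tsum_geometric_of_lt_one (by positivity) (inv_lt_one_of_one_lt₀ hr)]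
  have := sub_pos.2 hr
  field_simp

theorem fast_crossing_le (hρ : 1 < ρ) {i : ℕ} (hi : i + 1 < n) :
    (((∑ j ∈ Finset.range (i + 1), (fastEdge ρ η K n j + fastEdge ρ η K n (j + 1))) /
      fastEdge ρ η K n (i + 1) : ℝ≥0) : ℝ) ≤ K * (ρ : ℝ)⁻¹ ^ i + (ρ + 1) / (ρ - 1) := by
  have hρ' : (1 : ℝ) < ρ := by exact_mod_cast hρ
  have hρ1 : (0 : ℝ) < ρ - 1 := sub_pos.2 hρ'
  rw [sum_fastEdge_add_succ (by lia), fastEdge_succ_of_lt hi]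
  push_cast
  rw [inv_pow, div_le_iff₀ (by positivity)]
  calc (K : ℝ) + 2 * ∑ j ∈ Finset.range i, (ρ : ℝ) ^ j + ρ ^ i
      ≤ K + 2 * (ρ ^ i / (ρ - 1)) + ρ ^ i := by
        gcongr
        exact geom_sum_le_pow_div_sub_one hρ' i
    _ = (K * ((ρ : ℝ) ^ i)⁻¹ + (ρ + 1) / (ρ - 1)) * ρ ^ i := by
        field_simp
        ring

theorem fast_expectedHit_le (hn : 0 < n) (hρ : 1 < ρ) (hη : η ≠ 0) :
    (path.{u} (fastEdge ρ η K n)).expectedHit ⟨0⟩ {⟨n⟩} ≤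
      ENNReal.ofReal (K * (ρ / (ρ - 1)) + n * ((ρ + 1) / (ρ - 1)) +
        (1 + (K + 2 * (ρ ^ (n - 1) / (ρ - 1))) / η)) := by
  have hρ' : (1 : ℝ) < ρ := by exact_mod_cast hρ
  have : (0 : ℝ) < ρ - 1 := sub_pos.2 hρ'
  have hη' : (0 : ℝ) < η := by exact_mod_cast pos_iff_ne_zero.2 hη
  refine (path_expectedHit_le hn fun i hi =>
    fastEdge_succ_ne_zero (one_pos.trans hρ).ne' hη hi).trans ?_
  rw [← ENNReal.ofReal_coe_nnreal]
  refine ENNReal.ofReal_le_ofReal ?_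
  obtain ⟨k, rfl⟩ := Nat.exists_eq_add_one.2 hn
  rw [Finset.sum_range_succ, NNReal.coe_add, Nat.add_sub_cancel]
  refine add_le_add ?_ ?_
  · rw [NNReal.coe_sum]
    refine (Finset.sum_le_sum fun i hi => fast_crossing_le hρ
      (Nat.succ_lt_succ (Finset.mem_range.1 hi))).trans ?_
    rw [Finset.sum_add_distrib, ← Finset.mul_sum, Finset.sum_const, Finset.card_range,
      nsmul_eq_mul]
    gcongr
    · exact geom_sum_inv_le hρ' k
    · exact k.le_succ
  · rw [sum_fastEdge_add_succ k.lt_succ_self, fastEdge_self k.succ_pos]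
    push_cast
    rw [add_div, div_self hη'.ne', add_comm]
    gcongr
    exact geom_sum_le_pow_div_sub_one hρ' k

theorem fast_le_laplace (hn : 2 ≤ n) (hρ : ρ ≠ 0) (hη : η ≠ 0) {s l : ℝ} (hs : 1 ≤ s) (hl : 0 < l)
    (hstart : (Real.exp l - 1) * (K + 1) ≤ s - 1) (hmid : Real.exp l * (1 + ρ) ≤ s⁻¹ + ρ * s)
    (hend : Real.exp l * (ρ ^ (n - 2) + η) ≤ ρ ^ (n - 2) * s⁻¹ + η * 2) :
    ENNReal.ofReal (1 / (2 * s ^ (n - 1))) ≤ ⨆ N,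
      (path.{u} (fastEdge ρ η K n)).laplace {⟨n⟩} (ENNReal.ofReal (Real.exp (-l))) N ⟨0⟩ := by
  have hs0 : 0 < s := one_pos.trans_le hs
  let φ : ℕ → ℝ := fun i => if i < n then s ^ i else 2 * s ^ (n - 1)
  have hφ : ∀ i < n, φ i = s ^ i := fun i hi => if_pos hi
  have hφn : φ n = 2 * s ^ (n - 1) := if_neg (lt_irrefl n)
  have hzero : φ 0 = 1 := by rw [hφ 0 (by lia), pow_zero]
  rw [← hzero]
  refine path_le_iSup_laplace (by lia) (fun i hi => fastEdge_succ_ne_zero hρ hη hi) hl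
    (by positivity) (fun i _ => ?_) (fun i _ => ?_) ?_
  · dsimp only [φ]
    split_ifs <;> positivity
  · dsimp only [φ]
    split_ifs with hi
    · have := pow_le_pow_right₀ hs (Nat.le_sub_one_of_lt hi)
      linarith [pow_pos hs0 (n - 1)]
    · exact le_rfl
  rintro (_ | i) hi
  · rw [hzero, hφ 1 (by lia), fastEdge_succ_of_lt (by lia)]
    simp only [fastEdge, pow_zero, pow_one, NNReal.coe_one]
    linarith
  rw [fastEdge_succ_of_lt (by lia), Nat.add_sub_cancel, hφ i (by lia), hφ (i + 1) hi]
  obtain hlt | rfl : i + 1 + 1 < n ∨ i + 1 + 1 = n := by lia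
  · rw [fastEdge_succ_of_lt hlt, hφ _ hlt]
    push_cast
    calc _ = (ρ : ℝ) ^ i * s ^ (i + 1) * (Real.exp l * (1 + ρ)) := by ring
      _ ≤ (ρ : ℝ) ^ i * s ^ (i + 1) * (s⁻¹ + ρ * s) := by gcongr
      _ = _ := by
        field_simp
        ring
  · rw [fastEdge_self (by lia), hφn]
    push_cast
    calc _ = (Real.exp l * (ρ ^ i + η)) * s ^ (i + 1) := by ring
      _ ≤ (ρ ^ i * s⁻¹ + η * 2) * s ^ (i + 1) := by
        gcongr
        exact hend
      _ = _ := by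
        field_simp
        ring

theorem fast_isAdmissible {c p : ℝ} (hn : 2 ≤ n) (h : (η : ℝ) < c * (n : ℝ) ^ p * (K + 1)) :
    (path.{u} (fastEdge ρ η K n)).IsAdmissible c p n ⟨0⟩ {⟨n⟩} := by
  have hstart : (path.{u} (fastEdge ρ η K n)).vertexWeight ⟨0⟩ = (K + 1 : ℝ≥0) := by
    rw [path_vertexWeight, fastEdge_succ_of_lt (by lia), pow_zero, fastEdge]
  have htarget : (path.{u} (fastEdge ρ η K n)).setWeight {⟨n⟩} = η := by
    rw [setWeight, tsum_singleton, path_vertexWeight, fastEdge_self (by lia), fastEdge_succ_self,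
      add_zero]
  have hK : (0 : ℝ) < (K + 1 : ℝ≥0) := by positivity
  refine ⟨?_, path_le_distTo _ n, ?_⟩
  · rw [hstart]
    exact_mod_cast hK
  · rw [hstart, htarget, ← ENNReal.ofReal_coe_nnreal, ← ENNReal.ofReal_coe_nnreal,
      ← ENNReal.ofReal_div_of_pos hK, ENNReal.ofReal_lt_ofReal_iff_of_nonneg (by positivity),
      div_lt_iff₀ hK]
    exact_mod_cast h

end FastPath

section FastGraph

/-- The drift `r` of the fast path, chosen so that `(1 + r) ^ n ≤ n ^ (p + 2) / log n ^ 5`; the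
logarithmic factor makes the path admissible for every constant `c`. -/
noncomputable def fastDrift (p : ℝ) (n : ℕ) : ℝ :=
  ((p + 2) * Real.log n - 5 * Real.log (Real.log n)) / n

/-- The weight of the loop at the start of the fast path. -/
noncomputable def fastLoop (n : ℕ) : ℝ≥0 := Real.toNNReal (n / Real.log n ^ 2)

/-- The ratio of the weights of successive edges of the fast path. -/
noncomputable def fastGrowth (p : ℝ) (n : ℕ) : ℝ≥0 := Real.toNNReal (1 + fastDrift p n)

/-- The asymptotically optimal path from `0` to `n`. -/
noncomputable def fastGraph (p : ℝ) (n : ℕ) : WeightedGraph (ULift.{u} ℕ) :=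
  path (fastEdge (fastGrowth p n) (fastGrowth p n ^ (n - 2) / fastLoop n) (fastLoop n) n)

theorem coe_fastLoop (n : ℕ) : (fastLoop n : ℝ) = n / Real.log n ^ 2 :=
  Real.coe_toNNReal _ (by positivity)

theorem coe_fastGrowth {p : ℝ} {n : ℕ} (h : 0 < fastDrift p n) :
    (fastGrowth p n : ℝ) = 1 + fastDrift p n :=
  Real.coe_toNNReal _ (by positivity)

theorem fastLoop_pos {n : ℕ} (hn : 0 < (n : ℝ)) (hlog : 0 < Real.log n) : 0 < fastLoop n :=
  Real.toNNReal_pos.2 (by positivity)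

theorem one_lt_fastGrowth {p : ℝ} {n : ℕ} (h : 0 < fastDrift p n) : 1 < fastGrowth p n := by
  rw [← NNReal.coe_lt_coe, NNReal.coe_one, coe_fastGrowth h]
  exact lt_add_of_pos_right 1 h

theorem fastGrowth_pow_div_fastLoop_pos {p : ℝ} {n : ℕ} (h : 0 < fastDrift p n)
    (hn : 0 < (n : ℝ)) (hlog : 0 < Real.log n) :
    0 < fastGrowth p n ^ (n - 2) / fastLoop n :=
  div_pos (pow_pos (one_pos.trans (one_lt_fastGrowth h)) _) (fastLoop_pos hn hlog)

theorem tendsto_fastDrift_div (p : ℝ) :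
    Tendsto (fun n : ℕ => fastDrift p n / (Real.log n / n)) atTop (𝓝 (p + 2)) := by
  have hlim := (tendsto_log_log_div_log.const_mul 5).const_sub (p + 2)
  rw [mul_zero, sub_zero] at hlim
  refine hlim.congr' ?_
  filter_upwards [eventually_natCast_pos_and_log_pos] with n ⟨hn, hlog⟩
  rw [fastDrift]
  field_simp

theorem tendsto_fastDrift (p : ℝ) : Tendsto (fastDrift p) atTop (𝓝 0) := by
  have hlim := (tendsto_fastDrift_div p).mul tendsto_log_div_natCast
  rw [mul_zero] at hlim
  refine hlim.congr' ?_
  filter_upwards [eventually_natCast_pos_and_log_pos] with n ⟨hn, hlog⟩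
  exact div_mul_cancel₀ _ (by positivity)

theorem eventually_fastDrift_pos {p : ℝ} (hp : -2 < p) : ∀ᶠ n in atTop, 0 < fastDrift p n := by
  filter_upwards [(tendsto_fastDrift_div p).eventually_const_lt (show 0 < p + 2 by linarith),
    eventually_natCast_pos_and_log_pos] with n h ⟨hn, hlog⟩
  exact (div_pos_iff_of_pos_right (by positivity)).1 h

theorem one_add_fastDrift_pow_le {p : ℝ} {n : ℕ} (h : 0 < fastDrift p n) (hn : 0 < (n : ℝ))
    (hlog : 0 < Real.log n) :
    (1 + fastDrift p n) ^ (n - 2) ≤ (n : ℝ) ^ (p + 2) / Real.log n ^ 5 :=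
  calc (1 + fastDrift p n) ^ (n - 2) ≤ (1 + fastDrift p n) ^ n :=
        pow_le_pow_right₀ (by linarith) (n.sub_le 2)
    _ ≤ Real.exp (fastDrift p n) ^ n := by
        gcongr
        exact (add_comm _ _).trans_le (Real.add_one_le_exp _)
    _ = (n : ℝ) ^ (p + 2) / Real.log n ^ 5 := by
        rw [← Real.exp_nat_mul, fastDrift, mul_div_cancel₀ _ hn.ne', Real.exp_sub,
          Real.rpow_def_of_pos hn, mul_comm (Real.log n), ← Real.exp_log (pow_pos hlog 5),
          Real.log_pow, Nat.cast_ofNat]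

theorem eventually_fastGraph_isAdmissible {c p : ℝ} (hc : 0 < c) (hp : -2 < p) :
    ∀ᶠ n in atTop, (fastGraph.{u} p n).IsAdmissible c p n ⟨0⟩ {⟨n⟩} := by
  filter_upwards [eventually_fastDrift_pos hp, eventually_natCast_pos_and_log_pos,
    eventually_ge_atTop 2, (tendsto_const_div_log 1).eventually_lt_const hc]
    with n hr ⟨hn, hlog⟩ hn2 hc'
  refine fast_isAdmissible hn2 ?_
  rw [NNReal.coe_div, NNReal.coe_pow, coe_fastGrowth hr, coe_fastLoop]
  calc (1 + fastDrift p n) ^ (n - 2) / (n / Real.log n ^ 2)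
      ≤ (n : ℝ) ^ (p + 2) / Real.log n ^ 5 / (n / Real.log n ^ 2) := by
        gcongr
        exact one_add_fastDrift_pow_le hr hn hlog
    _ = 1 / Real.log n * (n : ℝ) ^ p * (n / Real.log n ^ 2) := by
        rw [Real.rpow_add hn, Real.rpow_ofNat]
        field_simp
    _ < c * (n : ℝ) ^ p * (n / Real.log n ^ 2) := by gcongr
    _ ≤ c * (n : ℝ) ^ p * (n / Real.log n ^ 2 + 1) := by gcongr; linarith

/-- A bound for the mean time to cross the fast path. -/
noncomputable def fastMean (p : ℝ) (n : ℕ) : ℝ :=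
  n * ((2 + fastDrift p n) / fastDrift p n) +
    3 * (fastLoop n * ((1 + fastDrift p n) / fastDrift p n)) + 1 + (fastLoop n : ℝ) ^ 2

theorem fastGraph_expectedHit_le {p : ℝ} {n : ℕ} (h : 0 < fastDrift p n) (hn : 2 ≤ n)
    (hlog : 0 < Real.log n) :
    (fastGraph.{u} p n).expectedHit ⟨0⟩ {⟨n⟩} ≤ ENNReal.ofReal (fastMean p n) := by
  have hn0 : (0 : ℝ) < n := by positivity
  refine (fast_expectedHit_le (by lia) (one_lt_fastGrowth h)
    (fastGrowth_pow_div_fastLoop_pos h hn0 hlog).ne').trans (ENNReal.ofReal_le_ofReal ?_)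
  have hK : (0 : ℝ) < fastLoop n := NNReal.coe_pos.2 (fastLoop_pos hn0 hlog)
  rw [NNReal.coe_div, NNReal.coe_pow, coe_fastGrowth h, add_sub_cancel_left, fastMean]
  set r := fastDrift p n
  set K : ℝ := (fastLoop n : ℝ)
  obtain ⟨m, rfl⟩ : ∃ m, n = m + 2 := ⟨n - 2, by lia⟩
  have hpow : 1 ≤ (1 + r) ^ m := one_le_pow₀ (by linarith)
  have hlast : (K + 2 * ((1 + r) ^ (m + 1) / r)) / ((1 + r) ^ m / K) ≤
      K ^ 2 + 2 * (K * ((1 + r) / r)) :=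
    calc (K + 2 * ((1 + r) ^ (m + 1) / r)) / ((1 + r) ^ m / K)
        = K ^ 2 / (1 + r) ^ m + 2 * (K * ((1 + r) / r)) := by
          field_simp
          ring
      _ ≤ K ^ 2 + 2 * (K * ((1 + r) / r)) := by
          gcongr
          exact div_le_self (sq_nonneg K) hpow
  calc _ ≤ K * ((1 + r) / r) + ((m + 2 : ℕ) : ℝ) * ((1 + r + 1) / r) +
        (1 + (K ^ 2 + 2 * (K * ((1 + r) / r)))) := by gcongr; exact hlast
    _ = _ := by ring

theorem tendsto_fastMean_div {p : ℝ} (hp : -2 < p) :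
    Tendsto (fun n : ℕ => fastMean p n / ((n : ℝ) ^ 2 / Real.log n)) atTop
      (𝓝 (2 / (p + 2))) := by
  have hp2 : p + 2 ≠ 0 := by linarith
  have hr := tendsto_fastDrift p
  have hv := tendsto_fastDrift_div p
  have hlog := tendsto_const_div_log 1
  have hmain := (hr.const_add 2).div hv hp2
  have hloop := ((((hr.const_add 1).div hv hp2).mul (hlog.pow 2)).const_mul 3)
  have hone := tendsto_log_div_natCast.mul tendsto_one_div_atTop_nhds_zero_nat
  have hlim := ((hmain.add hloop).add hone).add (hlog.pow 3)
  rw [show (2 + 0) / (p + 2) + 3 * ((1 + 0) / (p + 2) * 0 ^ 2) + 0 * 0 + 0 ^ 3 = 2 / (p + 2) by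
    ring] at hlim
  refine hlim.congr' ?_
  filter_upwards [eventually_natCast_pos_and_log_pos, eventually_fastDrift_pos hp]
    with n ⟨hn, hlog⟩ hr
  simp only [Pi.div_apply, fastMean, coe_fastLoop]
  field_simp

theorem eventually_fastGraph_expectedHit_le {p a : ℝ} (hp : -2 < p) (ha : 2 / (p + 2) < a) :
    ∀ᶠ n in atTop, (fastGraph.{u} p n).expectedHit ⟨0⟩ {⟨n⟩} ≤
      ENNReal.ofReal (a * ((n : ℝ) ^ 2 / Real.log n)) := by
  filter_upwards [eventually_fastDrift_pos hp, eventually_natCast_pos_and_log_pos,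
    eventually_ge_atTop 2, (tendsto_fastMean_div hp).eventually_lt_const ha]
    with n hr ⟨_, hlog⟩ hn2 hmean
  rw [div_lt_iff₀ (by positivity)] at hmean
  exact (fastGraph_expectedHit_le hr hn2 hlog).trans (ENNReal.ofReal_le_ofReal hmean.le)

theorem eventually_exp_killRate_sub_one_mul_le {ℓ σ : ℝ} (hℓ : 0 < ℓ) (hσ : 0 < σ) :
    ∀ᶠ n : ℕ in atTop,
      (Real.exp (killRate ℓ n) - 1) * (fastLoop n + 1) ≤ σ * (Real.log n / n) := by
  have hlim := (tendsto_exp_killRate_sub_one_div hℓ).mul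
    ((tendsto_const_div_log 1).add tendsto_log_div_natCast)
  rw [add_zero, mul_zero] at hlim
  filter_upwards [hlim.eventually_lt_const hσ, eventually_natCast_pos_and_log_pos]
    with n h ⟨hn, hlog⟩
  calc (Real.exp (killRate ℓ n) - 1) * (fastLoop n + 1)
      = (Real.exp (killRate ℓ n) - 1) / (Real.log n / n) ^ 2 *
          (1 / Real.log n + Real.log n / n) * (Real.log n / n) := by
        rw [coe_fastLoop]
        field_simp
    _ ≤ σ * (Real.log n / n) := by gcongr

theorem eventually_exp_killRate_mul_two_add_fastDrift_le {p ℓ σ : ℝ} (hℓ : 0 < ℓ) (hσ : 0 < σ)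
    (h : 2 * ℓ < σ ^ 2 + (p + 2) * σ) :
    ∀ᶠ n : ℕ in atTop, Real.exp (killRate ℓ n) * (2 + fastDrift p n) ≤
      (1 + σ * (Real.log n / n))⁻¹ + (1 + fastDrift p n) * (1 + σ * (Real.log n / n)) := by
  have hleft := (tendsto_exp_killRate_sub_one_div hℓ).mul ((tendsto_fastDrift p).const_add 2)
  have hright := ((tendsto_fastDrift_div p).mul_const σ).add
    ((tendsto_const_nhds (x := σ ^ 2)).div (tendsto_one_add_const_mul_log_div σ) one_ne_zero)
  filter_upwards [hleft.eventually_lt hright (by rw [add_zero, div_one]; linarith),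
    eventually_natCast_pos_and_log_pos] with n hlt ⟨hn, hlog⟩
  rw [← sub_nonneg]
  simp only [Pi.div_apply] at hlt
  set x := Real.log n / n
  have hx0 : 0 < x := by positivity
  calc (0 : ℝ) ≤ (fastDrift p n / x * σ + σ ^ 2 / (1 + σ * x) -
        (Real.exp (killRate ℓ n) - 1) / x ^ 2 * (2 + fastDrift p n)) * x ^ 2 :=
        mul_nonneg (sub_nonneg.2 hlt.le) (sq_nonneg x)
    _ = _ := by
        field_simp
        ring

theorem eventually_exp_killRate_mul_one_add_le {ℓ σ : ℝ} (hℓ : 0 < ℓ) (hσ : 0 < σ) :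
    ∀ᶠ n : ℕ in atTop, Real.exp (killRate ℓ n) * (1 + 1 / (fastLoop n : ℝ)) ≤
      (1 + σ * (Real.log n / n))⁻¹ + 2 / (fastLoop n : ℝ) := by
  have hleft := ((tendsto_exp_killRate_sub_one_div hℓ).mul tendsto_log_div_natCast).add
    ((tendsto_const_nhds (x := σ)).div (tendsto_one_add_const_mul_log_div σ) one_ne_zero)
  have hright : Tendsto (fun n : ℕ => Real.log n * (2 - Real.exp (killRate ℓ n))) atTop atTop := by
    refine tendsto_log_natCast_atTop.atTop_mul_pos one_pos ?_
    have hexp := ((Real.continuous_exp.tendsto 0).comp (tendsto_killRate ℓ)).const_sub 2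
    rwa [Real.exp_zero, show (2 : ℝ) - 1 = 1 by norm_num] at hexp
  filter_upwards [hleft.eventually_lt_const (lt_add_one _), hright.eventually_ge_atTop _,
    eventually_natCast_pos_and_log_pos] with n hlt hge ⟨hn, hlog⟩
  rw [← sub_nonneg, coe_fastLoop]
  simp only [Pi.div_apply] at hlt
  calc (0 : ℝ) ≤ (Real.log n * (2 - Real.exp (killRate ℓ n)) -
        ((Real.exp (killRate ℓ n) - 1) / (Real.log n / n) ^ 2 * (Real.log n / n) +
          σ / (1 + σ * (Real.log n / n)))) * (Real.log n / n) :=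
        mul_nonneg (sub_nonneg.2 (hlt.le.trans hge)) (by positivity)
    _ = _ := by
        field_simp
        ring

theorem eventually_one_div_le_fastGraph_laplace {p ℓ σ : ℝ} (hp : -2 < p) (hℓ : 0 < ℓ) (hσ : 0 < σ)
    (h : 2 * ℓ < σ ^ 2 + (p + 2) * σ) :
    ∀ᶠ n : ℕ in atTop, ENNReal.ofReal (1 / (2 * (1 + σ * (Real.log n / n)) ^ (n - 1))) ≤ ⨆ N,
      (fastGraph.{u} p n).laplace {⟨n⟩} (ENNReal.ofReal (Real.exp (-killRate ℓ n))) N ⟨0⟩ := by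
  filter_upwards [eventually_exp_killRate_sub_one_mul_le hℓ hσ,
    eventually_exp_killRate_mul_two_add_fastDrift_le hℓ hσ h,
    eventually_exp_killRate_mul_one_add_le hℓ hσ, eventually_fastDrift_pos hp,
    eventually_natCast_pos_and_log_pos, eventually_ge_atTop 2, eventually_killRate_pos hℓ]
    with n hstart hmid hend hr ⟨hn, hlog⟩ hn2 hk
  refine fast_le_laplace hn2 (one_pos.trans (one_lt_fastGrowth hr)).ne'
    (fastGrowth_pow_div_fastLoop_pos hr hn hlog).ne'
    (le_add_of_nonneg_right (by positivity)) hk ?_ ?_ ?_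
  · rwa [add_sub_cancel_left]
  · rw [coe_fastGrowth hr, ← add_assoc, one_add_one_eq_two]
    exact hmid
  · have hscaled := mul_le_mul_of_nonneg_left hend (NNReal.coe_nonneg (fastGrowth p n ^ (n - 2)))
    push_cast at hscaled ⊢
    linear_combination hscaled

theorem eventually_le_fastGraph_laplace {p ℓ ε : ℝ} (hp : -2 < p) (hℓ : 0 < ℓ) (hε : 0 < ε) :
    ∀ᶠ n : ℕ in atTop,
      ENNReal.ofReal ((n : ℝ) ^ (-laplaceExponent ((p + 2) / 2) ℓ - ε)) ≤ ⨆ N,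
        (fastGraph.{u} p n).laplace {⟨n⟩} (ENNReal.ofReal (Real.exp (-killRate ℓ n))) N ⟨0⟩ := by
  set q := (p + 2) / 2 with hq
  set σ := laplaceExponent q ℓ + ε / 2 with hσ
  have hσ0 : 0 < σ := add_pos_of_nonneg_of_pos (laplaceExponent_nonneg q hℓ.le) (half_pos hε)
  have hquad : 2 * ℓ < σ ^ 2 + (p + 2) * σ := by
    have : √(q ^ 2 + 2 * ℓ) < σ + q := by
      rw [hσ, laplaceExponent]
      linarith
    rw [Real.sqrt_lt' (by linarith)] at this
    linear_combination this
  filter_upwards [eventually_one_div_le_fastGraph_laplace hp hℓ hσ0 hquad, eventually_gt_atTop 0,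
    (tendsto_natCast_rpow_neg (half_pos hε)).eventually_lt_const one_half_pos]
    with n hle hn hhalf
  have hn' : (0 : ℝ) < n := by positivity
  refine le_trans (ENNReal.ofReal_le_ofReal ?_) hle
  calc (n : ℝ) ^ (-laplaceExponent q ℓ - ε) = (n : ℝ) ^ (-(ε / 2)) * ((n : ℝ) ^ σ)⁻¹ := by
        rw [← Real.rpow_neg hn'.le, ← Real.rpow_add hn', hσ]
        ring_nf
    _ ≤ 1 / 2 * ((1 + σ * (Real.log n / n)) ^ (n - 1))⁻¹ := by
        gcongr
        exact one_add_const_mul_log_div_pow_le hσ0.le hn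
    _ = 1 / (2 * (1 + σ * (Real.log n / n)) ^ (n - 1)) := by ring

end FastGraph

section LowerBound

theorem eventually_three_mul_le_fastGraph_laplace {p ℓ ε : ℝ} (hp : -2 < p) (hℓ : 0 < ℓ)
    (hε : 0 < ε) :
    ∀ᶠ n : ℕ in atTop,
      3 * ENNReal.ofReal ((n : ℝ) ^ (-laplaceExponent ((p + 2) / 2) ℓ - ε)) ≤ ⨆ N,
        (fastGraph.{u} p n).laplace {⟨n⟩} (ENNReal.ofReal (Real.exp (-killRate ℓ n))) N ⟨0⟩ := by
  filter_upwards [eventually_le_fastGraph_laplace hp hℓ (half_pos hε), eventually_gt_atTop 0,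
    (tendsto_natCast_rpow_neg (half_pos hε)).eventually_lt_const (show (0 : ℝ) < 1 / 3 by simp)]
    with n hle hn hthird
  have hn' : (0 : ℝ) < n := by positivity
  refine le_trans ?_ hle
  rw [← ENNReal.ofReal_ofNat, ← ENNReal.ofReal_mul (by positivity)]
  refine ENNReal.ofReal_le_ofReal ?_
  set E := laplaceExponent ((p + 2) / 2) ℓ
  calc 3 * (n : ℝ) ^ (-E - ε) = 3 * (n : ℝ) ^ (-(ε / 2)) * (n : ℝ) ^ (-E - ε / 2) := by
        rw [mul_assoc, ← Real.rpow_add hn']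
        ring_nf
    _ ≤ 1 * (n : ℝ) ^ (-E - ε / 2) := by
        gcongr
        linarith
    _ = (n : ℝ) ^ (-E - ε / 2) := one_mul _

theorem eventually_fastGraph_laplace_le_add_probHitBefore {p ℓ ϑ α α' ε : ℝ} (hp : -2 < p)
    (hϑ : 0 < ϑ) (hϑℓ : ϑ < ℓ) (hε : 0 < ε)
    (hα' : laplaceExponent ((p + 2) / 2) ℓ + ϑ * α' + 2 * ε ≤
      laplaceExponent ((p + 2) / 2) (ℓ + ϑ))
    (hα : laplaceExponent ((p + 2) / 2) ℓ - ϑ * α + 2 * ε ≤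
      laplaceExponent ((p + 2) / 2) (ℓ - ϑ)) :
    ∀ᶠ n : ℕ in atTop, ∀ N,
      (fastGraph.{u} p n).laplace {⟨n⟩} (ENNReal.ofReal (Real.exp (-killRate ℓ n))) N ⟨0⟩ ≤
        ENNReal.ofReal ((n : ℝ) ^ (-laplaceExponent ((p + 2) / 2) ℓ - ε)) +
        ENNReal.ofReal (Real.exp (-(Real.log n * (ℓ * α')))) *
          (fastGraph.{u} p n).probHitBefore ⟨0⟩ {⟨n⟩} (α * (n : ℝ) ^ 2 / Real.log n) +
        ENNReal.ofReal ((n : ℝ) ^ (-laplaceExponent ((p + 2) / 2) ℓ - ε)) := by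
  have hℓ : 0 < ℓ := hϑ.trans hϑℓ
  filter_upwards [eventually_laplace_le.{u} p one_pos (add_pos hℓ hϑ) hε,
    eventually_laplace_le.{u} p one_pos (sub_pos.2 hϑℓ) hε,
    eventually_fastGraph_isAdmissible.{u} one_pos hp, eventually_natCast_pos_and_log_pos,
    eventually_gt_atTop 0, eventually_killRate_pos hℓ, eventually_killRate_pos hϑ]
    with n hadd hsub hadm ⟨hn, hlog⟩ hn0 hkℓ hkϑ N
  have hsplit := (fastGraph.{u} p n).laplace_le_add_probHitBefore_add (hadm.notMem hn0) hkℓ.le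
    hkϑ.le (α' * (n : ℝ) ^ 2 / Real.log n) (α * (n : ℝ) ^ 2 / Real.log n) N
  rw [← killRate_add, ← killRate_sub, killRate_mul ϑ α' hn hlog, killRate_mul ℓ α' hn hlog,
    killRate_mul ϑ α hn hlog, ← mul_neg (Real.log n) (ϑ * α)] at hsplit
  refine hsplit.trans (add_le_add (add_le_add ?_ le_rfl) ?_)
  · exact ofReal_exp_mul_le_ofReal_rpow hn0 (hadd _ _ _ _ hadm N) (by linarith)
  · exact ofReal_exp_mul_le_ofReal_rpow hn0 (hsub _ _ _ _ hadm N) (by linarith)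

theorem eventually_le_fastGraph_probHitBefore {p ℓ f' α α' δ : ℝ} (hp : -2 < p) (hℓ : 0 < ℓ)
    (hf : HasDerivAt (laplaceExponent ((p + 2) / 2)) f' ℓ) (hα' : α' < f') (hα : f' < α)
    (hδ : 0 < δ) :
    ∀ᶠ n : ℕ in atTop,
      ENNReal.ofReal ((n : ℝ) ^ (ℓ * α' - laplaceExponent ((p + 2) / 2) ℓ - δ)) ≤
        (fastGraph.{u} p n).probHitBefore ⟨0⟩ {⟨n⟩} (α * (n : ℝ) ^ 2 / Real.log n) := by
  obtain ⟨ϑ, hϑ, hϑℓ, hright, hleft⟩ := exists_lt_chord hf hα' hα hℓ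
  obtain ⟨ε, hε, hεlt⟩ := exists_between
    (lt_min hδ (lt_min (half_pos (sub_pos.2 hright)) (half_pos (sub_pos.2 hleft))))
  rw [lt_min_iff, lt_min_iff] at hεlt
  obtain ⟨hεδ, hεright, hεleft⟩ := hεlt
  filter_upwards [eventually_three_mul_le_fastGraph_laplace.{u} hp hℓ hε,
    eventually_fastGraph_laplace_le_add_probHitBefore.{u} (α := α) (α' := α') hp hϑ hϑℓ hε
      (by linarith) (by linarith), eventually_gt_atTop 0] with n hlow hup hn
  have hn' : (0 : ℝ) < n := by positivity
  have hdominant := le_of_three_mul_le_add_add ENNReal.ofReal_ne_top (hlow.trans (iSup_le hup))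
  set P := (fastGraph.{u} p n).probHitBefore ⟨0⟩ {⟨n⟩} (α * (n : ℝ) ^ 2 / Real.log n)
  set E := laplaceExponent ((p + 2) / 2) ℓ
  calc ENNReal.ofReal ((n : ℝ) ^ (ℓ * α' - E - δ))
      ≤ ENNReal.ofReal (Real.exp (Real.log n * (ℓ * α')) * (n : ℝ) ^ (-E - ε)) := by
        rw [← Real.rpow_def_of_pos hn', ← Real.rpow_add hn']
        exact ENNReal.ofReal_le_ofReal
          (Real.rpow_le_rpow_of_exponent_le (by exact_mod_cast hn) (by linarith))
    _ ≤ ENNReal.ofReal (Real.exp (Real.log n * (ℓ * α'))) *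
          (ENNReal.ofReal (Real.exp (-(Real.log n * (ℓ * α')))) * P) := by
        rw [ENNReal.ofReal_mul (Real.exp_pos _).le]
        gcongr
    _ = P := by
        rw [← mul_assoc, ← ENNReal.ofReal_mul (Real.exp_pos _).le, ← Real.exp_add, add_neg_cancel,
          Real.exp_zero, ENNReal.ofReal_one, one_mul]

theorem IsAdmissible.probHitBefore_le_supProbHit [MeasurableSpace V] [DiscreteMeasurableSpace V]
    {G : WeightedGraph V} {c p : ℝ} {n : ℕ} {o z : V} (h : G.IsAdmissible c p n o {z}) (t : ℝ) :
    G.probHitBefore o {z} t ≤ supProbHit.{u} c p n t :=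
  le_iSup_of_le V (le_iSup_of_le _ (le_iSup_of_le inferInstance (le_iSup_of_le G
    (le_iSup_of_le o (le_iSup_of_le z (le_iSup_of_le h le_rfl))))))

theorem IsAdmissible.infExpectedHit_le [MeasurableSpace V] [DiscreteMeasurableSpace V]
    {G : WeightedGraph V} {c p : ℝ} {n : ℕ} {o z : V} (h : G.IsAdmissible c p n o {z}) :
    infExpectedHit.{u} c p n ≤ G.expectedHit o {z} :=
  iInf_le_of_le V (iInf_le_of_le _ (iInf_le_of_le inferInstance (iInf_le_of_le G
    (iInf_le_of_le o (iInf_le_of_le z (iInf_le_of_le h le_rfl))))))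

theorem supProbHit_le_supProbHitSet (c p : ℝ) (n : ℕ) (t : ℝ) :
    supProbHit.{u} c p n t ≤ supProbHitSet.{u} c p n t := by
  simp only [supProbHit, iSup_le_iff]
  intro V _ _ G o z h
  exact le_iSup_of_le V (le_iSup_of_le _ (le_iSup_of_le inferInstance (le_iSup_of_le G
    (le_iSup_of_le o (le_iSup_of_le {z} (le_iSup_of_le h le_rfl))))))

theorem infExpectedHitSet_le_infExpectedHit (c p : ℝ) (n : ℕ) :
    infExpectedHitSet.{u} c p n ≤ infExpectedHit.{u} c p n := by
  simp only [infExpectedHit, le_iInf_iff]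
  intro V _ _ G o z h
  exact iInf_le_of_le V (iInf_le_of_le _ (iInf_le_of_le inferInstance (iInf_le_of_le G
    (iInf_le_of_le o (iInf_le_of_le {z} (iInf_le_of_le h le_rfl))))))

variable {c p α : ℝ}

theorem eventually_infExpectedHit_le {a : ℝ} (hc : 0 < c) (hp : -2 < p) (ha : 2 / (p + 2) < a) :
    ∀ᶠ n : ℕ in atTop, infExpectedHit.{u} c p n ≤
      ENNReal.ofReal (a * ((n : ℝ) ^ 2 / Real.log n)) := by
  filter_upwards [eventually_fastGraph_isAdmissible.{u} hc hp,
    eventually_fastGraph_expectedHit_le.{u} hp ha] with n hadm hle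
  exact hadm.infExpectedHit_le.trans hle

theorem eventually_le_supProbHit {ε : ℝ} (hc : 0 < c) (hp : -2 < p) (hα : 0 < α)
    (hα' : α < 2 / (p + 2)) (hε : 0 < ε) :
    ∀ᶠ n : ℕ in atTop, ENNReal.ofReal ((n : ℝ) ^ (-(α * (p + 2) - 2) ^ 2 / (8 * α) - ε)) ≤
      supProbHit.{u} c p n (α * (n : ℝ) ^ 2 / Real.log n) := by
  rw [lt_div_iff₀ (by linarith)] at hα'
  have hlimit := (tendsto_dualRate_mul_sub_laplaceExponent p hα).eventually_const_lt
    (sub_lt_self _ (half_pos hε))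
  obtain ⟨t, hexponent, ht, htα⟩ :=
    ((hlimit.filter_mono nhdsWithin_le_nhds).and (Ioo_mem_nhdsGT hα)).exists
  have hrate : 0 < dualRate ((p + 2) / 2) (α - t) :=
    dualRate_pos (by linarith) (by linarith) (by nlinarith)
  filter_upwards [eventually_le_fastGraph_probHitBefore.{u} hp hrate
    (hasDerivAt_laplaceExponent_dualRate _ (by linarith)) (show α - 2 * t < α - t by linarith)
    (show α - t < α by linarith) (half_pos hε), eventually_fastGraph_isAdmissible.{u} hc hp,
    eventually_gt_atTop 0] with n hle hadm hn
  refine le_trans (ENNReal.ofReal_le_ofReal ?_) (hle.trans (hadm.probHitBefore_le_supProbHit _))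
  exact Real.rpow_le_rpow_of_exponent_le (by exact_mod_cast hn) (by linarith)

end LowerBound

end WeightedGraph

theorem theorem5 (c p : ℝ) (hc : 0 < c) (hp : -2 < p) :
    -- the expected hitting time, for a target vertex and for a target set
    ((fun n : ℕ => (infExpectedHit.{u} c p n).toReal) ~[atTop]
        fun n : ℕ => 2 * (n : ℝ) ^ 2 / ((p + 2) * Real.log n)) ∧
    ((fun n : ℕ => (infExpectedHitSet.{u} c p n).toReal) ~[atTop]
        fun n : ℕ => 2 * (n : ℝ) ^ 2 / ((p + 2) * Real.log n)) ∧
    -- the large deviations, for a target vertex and for a target set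
    ∀ α : ℝ, 0 < α → α < 2 / (p + 2) →
      (∃ ε : ℕ → ℝ, Tendsto ε atTop (𝓝 0) ∧ ∀ᶠ n : ℕ in atTop,
        supProbHit.{u} c p n (α * (n : ℝ) ^ 2 / Real.log n) =
          ENNReal.ofReal ((n : ℝ) ^ (-(α * (p + 2) - 2) ^ 2 / (8 * α) + ε n))) ∧
      (∃ ε : ℕ → ℝ, Tendsto ε atTop (𝓝 0) ∧ ∀ᶠ n : ℕ in atTop,
        supProbHitSet.{u} c p n (α * (n : ℝ) ^ 2 / Real.log n) =
          ENNReal.ofReal ((n : ℝ) ^ (-(α * (p + 2) - 2) ^ 2 / (8 * α) + ε n))) := by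
  have hp2 : 0 < p + 2 := by linarith
  have hscale : (fun n : ℕ => 2 * (n : ℝ) ^ 2 / ((p + 2) * Real.log n)) =
      fun n : ℕ => 2 / (p + 2) * ((n : ℝ) ^ 2 / Real.log n) :=
    funext fun n => mul_div_mul_comm _ _ _ _
  have hscale_pos : ∀ᶠ n : ℕ in atTop, 0 < (n : ℝ) ^ 2 / Real.log n :=
    eventually_natCast_pos_and_log_pos.mono fun n ⟨hn, hlog⟩ => by positivity
  have hmean := WeightedGraph.infExpectedHitSet_le_infExpectedHit.{u} c p
  have hprob := WeightedGraph.supProbHit_le_supProbHitSet.{u} c p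
  rw [hscale]
  refine ⟨isEquivalent_toReal_of_eventually_le (by positivity) hscale_pos
      (fun a ha => WeightedGraph.eventually_infExpectedHit_le hc hp ha)
      (fun a ha ha' => (WeightedGraph.eventually_le_infExpectedHitSet hc hp ha ha').mono
        fun n h => h.trans (hmean n)),
    isEquivalent_toReal_of_eventually_le (by positivity) hscale_pos
      (fun a ha => (WeightedGraph.eventually_infExpectedHit_le hc hp ha).mono
        fun n h => (hmean n).trans h)
      (fun a ha ha' => WeightedGraph.eventually_le_infExpectedHitSet hc hp ha ha'),
    fun α hα hα' => ⟨exists_tendsto_zero_eventually_eq_rpow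
      (fun ε hε => (WeightedGraph.eventually_supProbHitSet_le hc hp hα hα' hε).mono
        fun n h => (hprob n _).trans h)
      (fun ε hε => WeightedGraph.eventually_le_supProbHit hc hp hα hα' hε),
    exists_tendsto_zero_eventually_eq_rpow
      (fun ε hε => WeightedGraph.eventually_supProbHitSet_le hc hp hα hα' hε)
      (fun ε hε => (WeightedGraph.eventually_le_supProbHit hc hp hα hα' hε).mono
        fun n h => h.trans (hprob n _))⟩⟩
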